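/- **Setting.** Let $(\mathcal E,\mathcal F)$ be a resistance form on a nonempty set $X$ and let $R$ be its resistance metric. Assume that $(X,R)$ is separable and locally compact, that its closed balls are compact, and that $(\mathcal E,\mathcal F)$ is regular, i.e. $\mathcal F\cap C_c(X)$ is uniformly dense in $C_c(X)$. Let $\mu$ be a Borel measure on $(X,R)$ with $0<\mu(B(x,r))<\infty$ for all $x\in X$, $r>0$. Let $\mathcal D(\mathcal E)$ be the domain of the closure of $(\mathcal E,\mathcal F\cap C_c(X))$ on $L^2(X,\mu)$. Let $(V_m)_m$ be an increasing sequence of finite subsets of $X$ with dense union. The restriction of $\mathcal E$ to $V_m$ has the form $\frac12\sum_{p,q\in V_m}c(m;p,q)(u(p)-u(q))^2$ with symmetric $c(m;p,q)\ge 0$. For $g\in C_c(X)$, $f\in\mathcal F\cap C_c(X)$ and $v:X\times X\to\mathbb R$ put $(g\cdot v)(x,y)=\frac12(g(x)+g(y))v(x,y)$ and $d_uf(x,y)=f(x)-f(y)$. Let $\mathcal H$ be the Hilbert space obtained from the finite linear combinations of functions $g\cdot d_uf$ by factoring and completing with respect to $$\langle \omega,\eta\rangle_{\mathcal H}=\lim_{m\to\infty}\frac12\sum_{p,q\in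 V_m}c(m;p,q)\,\omega(p,q)\,\eta(p,q).$$ Let $\partial f\in\mathcal H$ be the class of $d_uf$, and for $g\in\mathcal F\cap C_c(X)$ let $v\mapsto g\cdot v$ also denote the bounded extension of the action to $\mathcal H$. **Coefficients.** Let $a:\mathcal H\to\mathcal H$ be bounded, linear and symmetric with $\lambda\|v\|_{\mathcal H}^2\le\langle av,v\rangle_{\mathcal H}\le\Lambda\|v\|_{\mathcal H}^2$ for all $v\in\mathcal H$, where $0<\lambda<\Lambda$. Let $b,\hat b\in\mathcal H$ be in the Hardy class: there are constants $\delta(b),\delta(\hat b)\in(0,\infty)$, $\gamma(b),\gamma(\hat b)\in[0,\infty)$ such that $$\|g\cdot b\|_{\mathcal H}^2\le\delta(b)\,\mathcal E(g)+\gamma(b)\,\|g\|_{L^2(X,\mu)}^2,\qquad g\in\mathcal F\cap C_c(X),$$ and likewise for $\hat b$. Let $c\in L^\infty(X,\mu)$. Assume $$\lambda_0:=\tfrac12\Big(\lambda-\sqrt{\delta(b)}-\sqrt{\delta(\hat b)}\Big)>0,\qquad c_0:=\operatorname*{ess\,inf}_{x\in X}(-c(x))-\frac{\gamma(b)+\gamma(\hat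 b)}{2\lambda_0}>0 .$$ On $\mathcal F\cap C_c(X)$ let $$\mathcal Q(f,g)=\langle a\,\partial f,\partial g\rangle_{\mathcal H}-\langle g\cdot b,\partial f\rangle_{\mathcal H}-\langle f\cdot\hat b,\partial g\rangle_{\mathcal H}-\langle cf,g\rangle_{L^2(X,\mu)} .$$ **Statement.** The form $\mathcal Q$ extends to $\mathcal D(\mathcal E)$ by continuity: $\mathcal Q(u,v)=\lim_n\mathcal Q(f_n,g_n)$ whenever $f_n,g_n\in\mathcal F\cap C_c(X)$ are $\mathcal E$-Cauchy and converge in $L^2(X,\mu)$ to $u$ and $v$. Let $\mathcal L^{\mathcal Q}$ be its generator: $u\in\mathcal D(\mathcal L^{\mathcal Q})$ and $\mathcal L^{\mathcal Q}u=h\in L^2(X,\mu)$ iff $u\in\mathcal D(\mathcal E)$ and $\mathcal Q(u,v)=-\langle h,v\rangle_{L^2(X,\mu)}$ for all $v\in\mathcal D(\mathcal E)$. Then $\mathcal L^{\mathcal Q}$ generates a unique strongly continuous contraction semigroup $(T_t^{\mathcal Q})_{t\ge 0}$ on $L^2(X,\mu)$. Moreover there is $K>0$ for which the sector condition $$|\langle(-\mathcal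 L^{\mathcal Q}-\varepsilon)f,g\rangle|\le K\,\langle(-\mathcal L^{\mathcal Q}-\varepsilon)f,f\rangle^{1/2}\langle(-\mathcal L^{\mathcal Q}-\varepsilon)g,g\rangle^{1/2},\quad f,g\in\mathcal D(\mathcal L^{\mathcal Q}),\ 0\le\varepsilon\le c_0/2,\qquad (1)$$ holds, with inner products in $L^2(X,\mu)$. For any $\mathring u\in L^2(X,\mu)$ the function $u(t)=T_t^{\mathcal Q}\mathring u$ is the unique $u\in C^1((0,\infty),L^2(X,\mu))\cap C([0,\infty),L^2(X,\mu))$ with $u(t)\in\mathcal D(\mathcal L^{\mathcal Q})$ for $t>0$ and $$\partial_tu(t)=\mathcal L^{\mathcal Q}u(t),\quad t>0,\qquad u(0)=\mathring u .$$ For every $K>0$ there is a constant $C_K>0$, depending on nothing but $K$, such that whenever (1) holds with $K$, $$\mathcal Q(u(t))+\|u(t)\|_{L^2(X,\mu)}^2\le\Big(\frac{C_K}{t}+1\Big)\|\mathring u\|_{L^2(X,\mu)}^2,\qquad t>0 .$$ -/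

import Mathlib

open Filter Topology MeasureTheory
open scoped CompactlySupported

universe u

noncomputable section

/-- A resistance form on a set `X`: a domain `F` of real functions and a bilinear form `E` on it. -/
structure ResistanceForm (X : Type u) where
  F : Submodule ℝ (X → ℝ)
  E : LinearMap.BilinForm ℝ F
  symm : ∀ u v : F, E u v = E v u
  nonneg : ∀ u : F, 0 ≤ E u u
  const_mem : ∀ r : ℝ, (fun _ => r) ∈ F
  eq_zero_iff : ∀ u : F, E u u = 0 ↔ ∃ r : ℝ, ∀ x, u.1 x = r
  /-- Completeness of `F` modulo constants with respect to `E`. -/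
  complete : ∀ u : ℕ → F,
    (∀ ε > 0, ∃ N, ∀ m ≥ N, ∀ n ≥ N, E (u m - u n) (u m - u n) < ε) →
      ∃ v : F, Tendsto (fun n => E (u n - v) (u n - v)) atTop (𝓝 0)
  extension : ∀ (V : Finset X) (v : X → ℝ), ∃ u : F, ∀ x ∈ V, u.1 x = v x
  bddAbove : ∀ x y : X,
    BddAbove {r : ℝ | ∃ u : F, 0 < E u u ∧ r = (u.1 x - u.1 y) ^ 2 / E u u}
  markov : ∀ u : F, ∃ h : (fun x => max 0 (min 1 (u.1 x))) ∈ F, E ⟨_, h⟩ ⟨_, h⟩ ≤ E u u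

namespace ResistanceForm

variable {X : Type u} (S : ResistanceForm X)

/-- The resistance metric `R(x, y)`. -/
def resistance (x y : X) : ℝ :=
  sSup {r : ℝ | ∃ u : S.F, 0 < S.E u u ∧ r = (u.1 x - u.1 y) ^ 2 / S.E u u}

/-- The quadratic form `v ↦ E_V(v)` of the restriction of the resistance form to a finite set `V`
(only the values of `v` on `V` matter). -/
def traceEnergy (V : Finset X) (v : X → ℝ) : ℝ :=
  sInf {r : ℝ | ∃ u : S.F, (∀ x ∈ V, u.1 x = v x) ∧ r = S.E u u}

/-- The conductance between two distinct points `p` and `q` of the finite set `V`, that is,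
`- E_V(1_p, 1_q)`, written through polarization. See `traceEnergy_eq` and
`conductance_nonneg`. -/
def conductance (V : Finset X) (p q : X) : ℝ :=
  open Classical in
  if p = q then 0 else
    (S.traceEnergy V (Set.indicator {p} 1) + S.traceEnergy V (Set.indicator {q} 1)
      - S.traceEnergy V (Set.indicator {p} 1 + Set.indicator {q} 1)) / 2

theorem cauchy_schwarz (u v : S.F) : (S.E u v) ^ 2 ≤ S.E u u * S.E v v :=
  S.E.apply_sq_le_of_symm S.nonneg ⟨fun x y => S.symm x y⟩ u v

theorem energy_const (r : ℝ) : S.E ⟨_, S.const_mem r⟩ ⟨_, S.const_mem r⟩ = 0 :=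
  (S.eq_zero_iff _).2 ⟨r, fun _ => rfl⟩

theorem energy_const_right (u : S.F) (r : ℝ) : S.E u ⟨_, S.const_mem r⟩ = 0 := by
  have h := S.cauchy_schwarz u ⟨_, S.const_mem r⟩
  rw [S.energy_const, mul_zero] at h
  exact pow_eq_zero_iff (two_ne_zero) |>.1 (le_antisymm h (sq_nonneg _))

theorem sq_sub_le (u : S.F) (x y : X) :
    (u.1 x - u.1 y) ^ 2 ≤ S.resistance x y * S.E u u := by
  rcases (S.nonneg u).eq_or_lt with h | h
  · obtain ⟨r, hr⟩ := (S.eq_zero_iff u).1 h.symm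
    simp [hr, ← h]
  · rw [← div_le_iff₀ h]
    exact le_csSup (S.bddAbove x y) ⟨u, h, rfl⟩

theorem energy_add (u v : S.F) : S.E (u + v) (u + v) = S.E u u + 2 * S.E u v + S.E v v := by
  simp only [map_add, LinearMap.add_apply]
  rw [S.symm v u]; ring

theorem energy_sub (u v : S.F) : S.E (u - v) (u - v) = S.E u u - 2 * S.E u v + S.E v v := by
  simp only [map_sub, LinearMap.sub_apply]
  rw [S.symm v u]; ring

theorem energy_add_smul (u v : S.F) (t : ℝ) :
    S.E (u + t • v) (u + t • v) = S.E u u + 2 * t * S.E u v + t ^ 2 * S.E v v := by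
  rw [energy_add]
  simp only [map_smul, LinearMap.smul_apply, smul_eq_mul]; ring

/-- If `E(u_n - v) → 0` then differences of values converge. -/
theorem tendsto_diff {w : ℕ → S.F} {v : S.F}
    (h : Tendsto (fun n => S.E (w n - v) (w n - v)) atTop (𝓝 0)) (x y : X) :
    Tendsto (fun n => ((w n).1 x - v.1 x) - ((w n).1 y - v.1 y)) atTop (𝓝 0) := by
  have h1 : Tendsto (fun n => (((w n).1 x - v.1 x) - ((w n).1 y - v.1 y)) ^ 2) atTop (𝓝 0) := by
    refine squeeze_zero (fun n => sq_nonneg _) (fun n => S.sq_sub_le (w n - v) x y) ?_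
    simpa using h.const_mul (S.resistance x y)
  have h2 := h1.sqrt
  simp only [Real.sqrt_sq_eq_abs, Real.sqrt_zero] at h2
  exact (tendsto_zero_iff_abs_tendsto_zero _).2 h2

theorem tendsto_energy_left {w : ℕ → S.F} {v : S.F}
    (h : Tendsto (fun n => S.E (w n - v) (w n - v)) atTop (𝓝 0)) (z : S.F) :
    Tendsto (fun n => S.E (w n) z) atTop (𝓝 (S.E v z)) := by
  have h1 : Tendsto (fun n => (S.E (w n - v) z) ^ 2) atTop (𝓝 0) := by
    refine squeeze_zero (fun n => sq_nonneg _) (fun n => S.cauchy_schwarz (w n - v) z) ?_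
    simpa using h.mul_const (S.E z z)
  have h2 := h1.sqrt
  simp only [Real.sqrt_sq_eq_abs, Real.sqrt_zero] at h2
  have h3 := (tendsto_zero_iff_abs_tendsto_zero _).2 h2
  have h4 := h3.add_const (S.E v z)
  simpa using h4

/-- `w` is the harmonic extension of `v` from `V`. -/
def IsHarmonicExt (V : Finset X) (v : X → ℝ) (w : S.F) : Prop :=
  (∀ x ∈ V, w.1 x = v x) ∧ ∀ z : S.F, (∀ x ∈ V, z.1 x = 0) → S.E w z = 0

theorem traceEnergy_of_harmonic {V : Finset X} {v : X → ℝ} {w : S.F}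
    (h : S.IsHarmonicExt V v w) : S.traceEnergy V v = S.E w w := by
  apply IsLeast.csInf_eq
  refine ⟨⟨w, h.1, rfl⟩, ?_⟩
  rintro r ⟨z, hz, rfl⟩
  have h0 : S.E w (z - w) = 0 := h.2 _ fun x hx => by simp [hz x hx, h.1 x hx]
  have h1 := S.energy_add w (z - w)
  rw [add_sub_cancel, h0] at h1
  have := S.nonneg (z - w)
  linarith

theorem traceEnergy_le {V : Finset X} {v : X → ℝ} (z : S.F) (hz : ∀ x ∈ V, z.1 x = v x) :
    S.traceEnergy V v ≤ S.E z z :=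
  csInf_le ⟨0, by rintro r ⟨u, -, rfl⟩; exact S.nonneg u⟩ ⟨z, hz, rfl⟩

theorem exists_harmonic (V : Finset X) (v : X → ℝ) : ∃ w : S.F, S.IsHarmonicExt V v w := by
  classical
  rcases V.eq_empty_or_nonempty with rfl | ⟨x0, hx0⟩
  · exact ⟨0, by simp, by simp⟩
  set A : Set ℝ := {r : ℝ | ∃ u : S.F, (∀ x ∈ V, u.1 x = v x) ∧ r = S.E u u} with hA
  set m := sInf A with hm
  have hne : A.Nonempty := by
    obtain ⟨u, hu⟩ := S.extension V v
    exact ⟨_, u, hu, rfl⟩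
  have hlow : ∀ u : S.F, (∀ x ∈ V, u.1 x = v x) → m ≤ S.E u u := fun u hu =>
    S.traceEnergy_le u hu
  have hseq : ∀ n : ℕ, ∃ u : S.F, (∀ x ∈ V, u.1 x = v x) ∧ S.E u u < m + 1 / ((n : ℝ) + 1) := by
    intro n
    have hpos : (0 : ℝ) < 1 / ((n : ℝ) + 1) := Nat.one_div_pos_of_nat
    obtain ⟨r, ⟨u, hu, rfl⟩, hr⟩ := exists_lt_of_csInf_lt hne (lt_add_of_pos_right m hpos)
    exact ⟨u, hu, hr⟩
  choose w hwV hwE using hseq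
  have hdiff : ∀ i j, S.E (w i - w j) (w i - w j) ≤
      2 * (1 / ((i : ℝ) + 1)) + 2 * (1 / ((j : ℝ) + 1)) := by
    intro i j
    have h1 := hlow ((1 / 2 : ℝ) • (w i + w j)) fun x hx => by
      simp [hwV i x hx, hwV j x hx]; ring
    simp only [map_smul, LinearMap.smul_apply, smul_eq_mul] at h1
    have h2 := S.energy_add (w i) (w j)
    have h3 := S.energy_sub (w i) (w j)
    have h4 := hwE i
    have h5 := hwE j
    linarith
  have htend : Tendsto (fun n : ℕ => 1 / ((n : ℝ) + 1)) atTop (𝓝 0) :=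
    tendsto_one_div_add_atTop_nhds_zero_nat
  obtain ⟨v0, hv0⟩ := S.complete w (by
    intro ε hε
    obtain ⟨N, hN⟩ := eventually_atTop.1 (htend.eventually (gt_mem_nhds (by positivity : (0:ℝ) < ε / 4)))
    refine ⟨N, fun i hi j hj => ?_⟩
    have := hdiff i j
    have := hN i hi
    have := hN j hj
    linarith)
  refine ⟨v0 + ⟨_, S.const_mem (v x0 - v0.1 x0)⟩, ?_, ?_⟩
  · intro x hx
    have h := S.tendsto_diff hv0 x x0
    simp only [hwV _ x hx, hwV _ x0 hx0] at h
    have := tendsto_nhds_unique h tendsto_const_nhds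
    simp only [Submodule.coe_add, Pi.add_apply]
    linarith
  · intro z hz
    have hz0 : S.E v0 z = 0 := by
      have key : ∀ t : ℝ, 0 ≤ 2 * t * S.E v0 z + t ^ 2 * S.E z z := by
        intro t
        have h1 : ∀ n : ℕ, -(1 / ((n : ℝ) + 1)) ≤ 2 * t * S.E (w n) z + t ^ 2 * S.E z z := by
          intro n
          have h1 := hlow (w n + t • z) fun x hx => by simp [hwV n x hx, hz x hx]
          rw [S.energy_add_smul] at h1
          have := hwE n
          linarith
        have h2 : Tendsto (fun n => 2 * t * S.E (w n) z + t ^ 2 * S.E z z) atTop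
            (𝓝 (2 * t * S.E v0 z + t ^ 2 * S.E z z)) :=
          ((S.tendsto_energy_left hv0 z).const_mul _).add_const _
        have h3 := le_of_tendsto_of_tendsto' htend.neg h2 h1
        simpa using h3
      by_contra hne0
      have hz' := S.nonneg z
      have := key (-(S.E v0 z) / (S.E z z + 1))
      have hp : 0 < S.E z z + 1 := by linarith
      have e : 2 * (-(S.E v0 z) / (S.E z z + 1)) * S.E v0 z
          + (-(S.E v0 z) / (S.E z z + 1)) ^ 2 * S.E z z
          = -((S.E v0 z) ^ 2 * (S.E z z + 2)) / (S.E z z + 1) ^ 2 := by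
        field_simp; ring
      rw [e, div_nonneg_iff] at this
      have h6 : 0 < (S.E v0 z) ^ 2 * (S.E z z + 2) := by positivity
      rcases this with ⟨h, -⟩ | ⟨-, h⟩
      · linarith
      · have : 0 < (S.E z z + 1) ^ 2 := by positivity
        linarith
    rw [map_add, LinearMap.add_apply, hz0, S.symm _ z, S.energy_const_right, add_zero]

theorem IsHarmonicExt.add {V : Finset X} {v v' : X → ℝ} {w w' : S.F}
    (h : S.IsHarmonicExt V v w) (h' : S.IsHarmonicExt V v' w') :
    S.IsHarmonicExt V (v + v') (w + w') :=
  ⟨fun x hx => by simp [h.1 x hx, h'.1 x hx],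
    fun z hz => by rw [map_add, LinearMap.add_apply, h.2 z hz, h'.2 z hz, add_zero]⟩

theorem conductance_eq {V : Finset X} {p q : X} (hpq : p ≠ q) {hp hq : S.F}
    (h : S.IsHarmonicExt V (Set.indicator {p} 1) hp)
    (h' : S.IsHarmonicExt V (Set.indicator {q} 1) hq) :
    S.conductance V p q = - S.E hp hq := by
  rw [conductance, if_neg hpq, S.traceEnergy_of_harmonic h, S.traceEnergy_of_harmonic h',
    S.traceEnergy_of_harmonic (h.add S h'), S.energy_add]
  ring

theorem conductance_nonneg {V : Finset X} (p q : X) :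
    0 ≤ S.conductance V p q := by
  classical
  by_cases hpq : p = q
  · simp [conductance, hpq]
  obtain ⟨hp, h⟩ := S.exists_harmonic V (Set.indicator {p} 1)
  obtain ⟨hq, h'⟩ := S.exists_harmonic V (Set.indicator {q} 1)
  rw [S.conductance_eq hpq h h']
  have key : ∀ t : ℝ, 0 < t → 2 * S.E hp hq ≤ t * S.E hq hq := by
    intro t ht
    obtain ⟨hmem, hle⟩ := S.markov (hp + (-t) • hq)
    have h1 : S.traceEnergy V (Set.indicator {p} 1) ≤ _ := S.traceEnergy_le ⟨_, hmem⟩ (by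
      intro x hx
      simp only [Submodule.coe_add, Pi.add_apply, Submodule.coe_smul, Pi.smul_apply, smul_eq_mul,
        h.1 x hx, h'.1 x hx]
      by_cases hxp : x = p
      · subst hxp; simp [hpq]
      · by_cases hxq : x = q
        · subst hxq; simp [hxp, ht.le]
        · simp [hxp, hxq])
    rw [S.traceEnergy_of_harmonic h] at h1
    have h2 := h1.trans hle
    rw [S.energy_add_smul] at h2
    have h3 : t * (2 * S.E hp hq) ≤ t * (t * S.E hq hq) := by linarith
    exact le_of_mul_le_mul_left h3 ht
  have h4 : Tendsto (fun t : ℝ => t * S.E hq hq) (𝓝[>] 0) (𝓝 (0 * S.E hq hq)) :=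
    ((continuous_id.mul continuous_const).tendsto 0).mono_left nhdsWithin_le_nhds
  have h5 := ge_of_tendsto h4 (eventually_nhdsWithin_of_forall fun t ht => key t ht)
  linarith

theorem conductance_symm (V : Finset X) (p q : X) :
    S.conductance V p q = S.conductance V q p := by
  classical
  unfold conductance
  by_cases hpq : p = q
  · simp [hpq]
  · rw [if_neg hpq, if_neg (Ne.symm hpq), add_comm (Set.indicator {p} 1 : X → ℝ),
      add_comm (S.traceEnergy V (Set.indicator {p} 1))]

/-- The representation of the trace form through conductances. -/
theorem traceEnergy_eq (V : Finset X) (v : X → ℝ) :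
    S.traceEnergy V v = 1 / 2 * ∑ p ∈ V, ∑ q ∈ V, S.conductance V p q * (v p - v q) ^ 2 := by
  classical
  choose h hh using fun p : X => S.exists_harmonic V (Set.indicator {p} 1)
  have hw : S.IsHarmonicExt V v (∑ p ∈ V, v p • h p) := by
    constructor
    · intro x hx
      have : (∑ p ∈ V, v p • h p : S.F).1 x = ∑ p ∈ V, v p * (h p).1 x := by
        simp [Finset.sum_apply]
      rw [this, Finset.sum_congr rfl fun p _ => by rw [(hh p).1 x hx]]
      simp [Set.indicator_apply, hx]
    · intro z hz
      simp only [map_sum, LinearMap.sum_apply, map_smul, LinearMap.smul_apply]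
      exact Finset.sum_eq_zero fun p _ => by rw [(hh p).2 z hz, smul_zero]
  have hrow : ∀ p ∈ V, ∑ q ∈ V, S.E (h p) (h q) = 0 := by
    intro p _
    have h1 : S.E (h p) ((∑ q ∈ V, h q) - ⟨_, S.const_mem 1⟩) = 0 := by
      apply (hh p).2
      intro x hx
      have : (∑ q ∈ V, h q : S.F).1 x = ∑ q ∈ V, (h q).1 x := by
        simp [Finset.sum_apply]
      simp only [Submodule.coe_sub, Pi.sub_apply]
      rw [this, Finset.sum_congr rfl fun p _ => by rw [(hh p).1 x hx]]
      simp [Set.indicator_apply, hx]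
    rw [map_sub, S.energy_const_right, sub_zero, map_sum] at h1
    exact h1
  have hcol : ∀ q ∈ V, ∑ p ∈ V, S.E (h p) (h q) = 0 := by
    intro q hq
    rw [← hrow q hq]
    exact Finset.sum_congr rfl fun p _ => S.symm _ _
  rw [S.traceEnergy_of_harmonic hw]
  have e1 : ∀ p ∈ V, ∀ q ∈ V, S.conductance V p q * (v p - v q) ^ 2
      = 2 * (v p * (v q * S.E (h p) (h q))) - v p ^ 2 * S.E (h p) (h q)
        - v q ^ 2 * S.E (h p) (h q) := by
    intro p _ q _
    by_cases hpq : p = q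
    · subst hpq; ring
    · rw [S.conductance_eq hpq (hh p) (hh q)]; ring
  rw [Finset.sum_congr rfl fun p hp => Finset.sum_congr rfl (e1 p hp)]
  have z1 : ∑ p ∈ V, ∑ q ∈ V, v p ^ 2 * S.E (h p) (h q) = 0 :=
    Finset.sum_eq_zero fun p hp => by rw [← Finset.mul_sum, hrow p hp, mul_zero]
  have z2 : ∑ p ∈ V, ∑ q ∈ V, v q ^ 2 * S.E (h p) (h q) = 0 := by
    rw [Finset.sum_comm]
    exact Finset.sum_eq_zero fun q hq => by rw [← Finset.mul_sum, hcol q hq, mul_zero]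
  have z3 : S.E (∑ p ∈ V, v p • h p) (∑ q ∈ V, v q • h q)
      = ∑ p ∈ V, ∑ q ∈ V, v p * (v q * S.E (h p) (h q)) := by
    rw [map_sum S.E, LinearMap.sum_apply]
    refine Finset.sum_congr rfl fun p _ => ?_
    rw [map_smul, LinearMap.smul_apply, map_sum, smul_eq_mul, Finset.mul_sum]
    refine Finset.sum_congr rfl fun q _ => ?_
    rw [map_smul, smul_eq_mul]
  simp only [Finset.sum_sub_distrib, z1, z2, sub_zero]
  rw [z3]
  simp only [← Finset.mul_sum]
  ring

end ResistanceForm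

/-- A regular resistance form whose resistance metric is the metric of the space `X`. -/
structure RegularResistanceForm (X : Type u) [MetricSpace X] extends ResistanceForm X where
  dist_eq : ∀ x y : X, dist x y = toResistanceForm.resistance x y
  /-- Regularity: `F ∩ C_c(X)` is uniformly dense in `C_c(X)`. -/
  regular : ∀ (g : C_c(X, ℝ)) (ε : ℝ), 0 < ε →
    ∃ f ∈ F, Continuous f ∧ HasCompactSupport f ∧ ∀ x, |f x - g x| < ε

/-- An increasing sequence of finite subsets of `X` with dense union. -/
structure ExhaustingSequence (X : Type u) [MetricSpace X] where
  set : ℕ → Finset X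
  mono : Monotone set
  dense : Dense (⋃ m, (set m : Set X))

namespace RegularResistanceForm

variable {X : Type u} [MetricSpace X] (S : RegularResistanceForm X) (V : ExhaustingSequence X)

/-- The space `F ∩ C_c(X)`. -/
def core : Submodule ℝ (X → ℝ) where
  carrier := {f | f ∈ S.F ∧ Continuous f ∧ HasCompactSupport f}
  add_mem' := fun hf hg => ⟨S.F.add_mem hf.1 hg.1, hf.2.1.add hg.2.1, hf.2.2.add hg.2.2⟩
  zero_mem' := ⟨S.F.zero_mem, continuous_zero, HasCompactSupport.zero⟩
  smul_mem' := fun r _ hf => ⟨S.F.smul_mem r hf.1, hf.2.1.const_smul r,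
    hf.2.2.smul_left (f := fun _ => r)⟩

/-- An element of `F ∩ C_c(X)`, as an element of `F`. -/
def toF (f : S.core) : S.F := ⟨f.1, f.2.1⟩

/-- An element of `F ∩ C_c(X)`, as an element of `C_c(X)`. -/
def toCc (f : S.core) : C_c(X, ℝ) :=
  ⟨⟨f.1, f.2.2.1⟩, f.2.2.2⟩

/-- `E(f)` for `f` in `F ∩ C_c(X)`. -/
def energy (f : S.core) : ℝ := S.E (S.toF f) (S.toF f)

/-- The action `(g · v)(x, y) = (g(x) + g(y)) / 2 * v(x, y)`. -/
def act (g : X → ℝ) (v : X → X → ℝ) : X → X → ℝ := fun x y => (g x + g y) / 2 * v x y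

/-- The universal derivation `d_u f (x, y) = f(x) - f(y)`. -/
def univDeriv (f : X → ℝ) : X → X → ℝ := fun x y => f x - f y

/-- The space of finite linear combinations of functions `g · d_u f`, where `g ∈ C_c(X)` and
`f ∈ F ∩ C_c(X)`. -/
def omega : Submodule ℝ (X → X → ℝ) :=
  Submodule.span ℝ {ω | ∃ (g : C_c(X, ℝ)) (f : S.core), ω = act g (univDeriv f.1)}

/-- The sum `1/2 ∑_{p, q ∈ V_m} c(m; p, q) φ(p, q)`. -/
def discreteSum (m : ℕ) (φ : X → X → ℝ) : ℝ :=
  1 / 2 * ∑ p ∈ V.set m, ∑ q ∈ V.set m, S.conductance (V.set m) p q * φ p q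

theorem discreteSum_add (m : ℕ) (φ ψ : X → X → ℝ) :
    S.discreteSum V m (φ + ψ) = S.discreteSum V m φ + S.discreteSum V m ψ := by
  simp only [discreteSum, Pi.add_apply, mul_add, Finset.sum_add_distrib]

theorem discreteSum_smul (m : ℕ) (r : ℝ) (φ : X → X → ℝ) :
    S.discreteSum V m (r • φ) = r * S.discreteSum V m φ := by
  simp only [discreteSum, Pi.smul_apply, smul_eq_mul, Finset.mul_sum]
  refine Finset.sum_congr rfl fun p _ => Finset.sum_congr rfl fun q _ => ?_
  ring

theorem discreteSum_mono (m : ℕ) {φ ψ : X → X → ℝ} (h : ∀ x y, φ x y ≤ ψ x y) :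
    S.discreteSum V m φ ≤ S.discreteSum V m ψ := by
  unfold discreteSum
  refine mul_le_mul_of_nonneg_left (Finset.sum_le_sum fun p _ => Finset.sum_le_sum fun q _ => ?_)
    (by norm_num)
  exact mul_le_mul_of_nonneg_left (h p q) (S.conductance_nonneg p q)

theorem discreteSum_sq (m : ℕ) (f : X → ℝ) :
    S.discreteSum V m (univDeriv f * univDeriv f) = S.traceEnergy (V.set m) f := by
  rw [S.traceEnergy_eq]
  simp only [discreteSum, univDeriv, Pi.mul_apply, pow_two]

theorem continuous_of_mem (u : S.F) : Continuous u.1 := by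
  refine continuous_iff_continuousAt.2 fun x => ?_
  have h1 : Tendsto (fun y => (u.1 y - u.1 x) ^ 2) (𝓝 x) (𝓝 0) := by
    refine squeeze_zero (g := fun y => dist y x * S.E u u) (fun y => sq_nonneg _) (fun y => ?_) ?_
    · rw [S.dist_eq]; exact S.sq_sub_le u y x
    · have : Continuous fun y => dist y x * S.E u u := by fun_prop
      simpa using this.tendsto x
  have h2 := h1.sqrt
  simp only [Real.sqrt_sq_eq_abs, Real.sqrt_zero] at h2
  have h3 := ((tendsto_zero_iff_abs_tendsto_zero _).2 h2).add_const (u.1 x)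
  simpa [ContinuousAt] using h3

/-- A continuous function with bounded trace energies is in `F`, and its trace energies
converge to its energy. -/
theorem mem_of_bounded (u : X → ℝ) (hu : Continuous u) (M : ℝ)
    (hM : ∀ m, S.traceEnergy (V.set m) u ≤ M) :
    ∃ h : u ∈ S.F, Tendsto (fun m => S.traceEnergy (V.set m) u) atTop (𝓝 (S.E ⟨u, h⟩ ⟨u, h⟩)) := by
  choose w hw using fun m => S.exists_harmonic (V.set m) u
  have hE : ∀ m, S.traceEnergy (V.set m) u = S.E (w m) (w m) := fun m =>
    S.traceEnergy_of_harmonic (hw m)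
  have hpyth : ∀ m n, m ≤ n →
      S.E (w n - w m) (w n - w m) = S.E (w n) (w n) - S.E (w m) (w m) := by
    intro m n hmn
    have h0 : S.E (w m) (w n - w m) = 0 := (hw m).2 _ fun x hx => by
      simp [(hw m).1 x hx, (hw n).1 x (V.mono hmn hx)]
    have h1 := S.energy_add (w m) (w n - w m)
    rw [add_sub_cancel, h0] at h1
    linarith
  have hmono : Monotone fun m => S.E (w m) (w m) := fun m n hmn => by
    have := hpyth m n hmn
    have := S.nonneg (w n - w m)
    simp only
    linarith
  have hlim : ∃ L, Tendsto (fun m => S.E (w m) (w m)) atTop (𝓝 L) :=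
    ⟨_, tendsto_atTop_ciSup hmono ⟨M, by rintro _ ⟨m, rfl⟩; have := hM m; rw [hE m] at this; exact this⟩⟩
  obtain ⟨L, hL⟩ := hlim
  have hC := hL.cauchySeq
  have hsymm : ∀ m n, S.E (w m - w n) (w m - w n) = S.E (w n - w m) (w n - w m) := fun m n => by
    rw [S.energy_sub, S.energy_sub, S.symm (w m) (w n)]; ring
  obtain ⟨v, hv⟩ := S.complete w (by
    intro ε hε
    obtain ⟨N, hN⟩ := Metric.cauchySeq_iff.1 hC ε hε
    refine ⟨N, fun m hm n hn => ?_⟩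
    have h := hN m hm n hn
    rw [Real.dist_eq] at h
    have h' := abs_lt.1 h
    rcases le_total m n with hmn | hmn
    · rw [hsymm, hpyth m n hmn]; linarith
    · rw [hpyth n m hmn]; linarith)
  have hv_cont := S.continuous_of_mem v
  have hconst : ∃ r : ℝ, ∀ x, u x = v.1 x + r := by
    rcases isEmpty_or_nonempty X with hX | hX
    · exact ⟨0, fun x => (hX.false x).elim⟩
    obtain ⟨x0, hx0⟩ := V.dense.nonempty
    refine ⟨u x0 - v.1 x0, fun x => ?_⟩
    have heq : (fun x => u x) = fun x => v.1 x + (u x0 - v.1 x0) := by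
      refine Continuous.ext_on V.dense hu (by fun_prop) ?_
      intro x hx
      obtain ⟨i, hi⟩ := Set.mem_iUnion.1 hx
      obtain ⟨j, hj⟩ := Set.mem_iUnion.1 hx0
      have h1 := S.tendsto_diff hv x x0
      have h2 : Tendsto (fun n => ((w n).1 x - v.1 x) - ((w n).1 x0 - v.1 x0)) atTop
          (𝓝 ((u x - v.1 x) - (u x0 - v.1 x0))) := by
        refine tendsto_const_nhds.congr' ?_
        filter_upwards [eventually_ge_atTop (max i j)] with n hn
        rw [(hw n).1 x (V.mono (le_of_max_le_left hn) hi),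
          (hw n).1 x0 (V.mono (le_of_max_le_right hn) hj)]
      have := tendsto_nhds_unique h1 h2
      simp only
      linarith
    exact congrFun heq x
  obtain ⟨r, hr⟩ := hconst
  have hu_eq : u = (v + ⟨_, S.const_mem r⟩ : S.F).1 := by
    ext x; simp [hr x]
  have hmem : u ∈ S.F := hu_eq ▸ (v + ⟨_, S.const_mem r⟩ : S.F).2
  refine ⟨hmem, ?_⟩
  have hdiff : ∀ n, S.E (w n - v) (w n - v) = S.E ⟨u, hmem⟩ ⟨u, hmem⟩ - S.E (w n) (w n) := by
    intro n
    have h0 : S.E (w n) (⟨u, hmem⟩ - w n) = 0 := (hw n).2 _ fun x hx => by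
      simp [(hw n).1 x hx]
    have h1 := S.energy_add (w n) (⟨u, hmem⟩ - w n)
    rw [add_sub_cancel, h0] at h1
    have h2 : (⟨u, hmem⟩ - w n : S.F) = (v - w n) + ⟨_, S.const_mem r⟩ := by
      ext x; simp [hr x]; ring
    rw [h2, S.energy_add, S.energy_const_right, S.energy_const, S.energy_sub,
      S.symm v (w n)] at h1
    rw [S.energy_sub]
    linarith
  have h3 : Tendsto (fun n => S.E ⟨u, hmem⟩ ⟨u, hmem⟩ - S.E (w n - v) (w n - v)) atTop
      (𝓝 (S.E ⟨u, hmem⟩ ⟨u, hmem⟩ - 0)) := hv.const_sub _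
  rw [sub_zero] at h3
  refine h3.congr fun n => ?_
  rw [hdiff n, hE n]; ring

theorem tendsto_traceEnergy (u : S.F) :
    Tendsto (fun m => S.traceEnergy (V.set m) u.1) atTop (𝓝 (S.E u u)) := by
  obtain ⟨_, h⟩ := S.mem_of_bounded V u.1 (S.continuous_of_mem u) (S.E u u)
    fun m => S.traceEnergy_le u fun _ _ => rfl
  exact h

theorem tendsto_discreteSum_deriv (a b : S.F) :
    Tendsto (fun m => S.discreteSum V m (univDeriv a.1 * univDeriv b.1)) atTop (𝓝 (S.E a b)) := by
  have h := ((S.tendsto_traceEnergy V (a + b)).sub (S.tendsto_traceEnergy V (a - b))).const_mul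
    (1 / 4 : ℝ)
  have e : 1 / 4 * (S.E (a + b) (a + b) - S.E (a - b) (a - b)) = S.E a b := by
    rw [S.energy_add, S.energy_sub]; ring
  rw [e] at h
  refine h.congr fun m => ?_
  rw [← S.discreteSum_sq V, ← S.discreteSum_sq V]
  have e2 : univDeriv (a + b : S.F).1 * univDeriv (a + b : S.F).1
      = univDeriv (a - b : S.F).1 * univDeriv (a - b : S.F).1
        + (4 : ℝ) • (univDeriv a.1 * univDeriv b.1) := by
    ext x y
    simp [univDeriv]; ring
  rw [e2, S.discreteSum_add, S.discreteSum_smul]; ring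

theorem bounded_of_core (f : S.core) : ∃ A : ℝ, 0 ≤ A ∧ ∀ x, |f.1 x| ≤ A := by
  obtain ⟨A, hA⟩ := f.2.2.2.exists_bound_of_continuous f.2.2.1
  exact ⟨max A 0, le_max_right _ _, fun x => (hA x).trans (le_max_left _ _)⟩

theorem bounded_of_Cc (g : C_c(X, ℝ)) : ∃ A : ℝ, 0 ≤ A ∧ ∀ x, |g x| ≤ A := by
  obtain ⟨A, hA⟩ := g.hasCompactSupport'.exists_bound_of_continuous g.continuous
  exact ⟨max A 0, le_max_right _ _, fun x => (hA x).trans (le_max_left _ _)⟩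

/-- `F ∩ C_c(X)` is an algebra. -/
theorem mul_mem_core (V : ExhaustingSequence X) (f g : S.core) : f.1 * g.1 ∈ S.core := by
  obtain ⟨A, hA0, hA⟩ := S.bounded_of_core f
  obtain ⟨B, hB0, hB⟩ := S.bounded_of_core g
  have hc : Continuous (f.1 * g.1) := f.2.2.1.mul g.2.2.1
  obtain ⟨h, -⟩ := S.mem_of_bounded V (f.1 * g.1) hc
    (2 * A ^ 2 * S.energy g + 2 * B ^ 2 * S.energy f) (by
      intro m
      have h1 : S.traceEnergy (V.set m) g.1 ≤ S.energy g :=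
        S.traceEnergy_le (S.toF g) fun _ _ => rfl
      have h2 : S.traceEnergy (V.set m) f.1 ≤ S.energy f :=
        S.traceEnergy_le (S.toF f) fun _ _ => rfl
      have h3 : S.traceEnergy (V.set m) (f.1 * g.1) ≤
          2 * A ^ 2 * S.traceEnergy (V.set m) g.1 + 2 * B ^ 2 * S.traceEnergy (V.set m) f.1 := by
        rw [← S.discreteSum_sq V, ← S.discreteSum_sq V, ← S.discreteSum_sq V,
          ← S.discreteSum_smul, ← S.discreteSum_smul, ← S.discreteSum_add]
        refine S.discreteSum_mono V m fun x y => ?_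
        simp only [univDeriv, Pi.mul_apply, Pi.add_apply, Pi.smul_apply, smul_eq_mul]
        have e : f.1 x * g.1 x - f.1 y * g.1 y
            = f.1 x * (g.1 x - g.1 y) + g.1 y * (f.1 x - f.1 y) := by ring
        rw [e]
        have i1 : f.1 x ^ 2 ≤ A ^ 2 := sq_le_sq.2 (by rw [abs_of_nonneg hA0]; exact hA x)
        have i2 : g.1 y ^ 2 ≤ B ^ 2 := sq_le_sq.2 (by rw [abs_of_nonneg hB0]; exact hB y)
        have j1 := mul_le_mul_of_nonneg_right i1 (sq_nonneg (g.1 x - g.1 y))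
        have j2 := mul_le_mul_of_nonneg_right i2 (sq_nonneg (f.1 x - f.1 y))
        nlinarith [sq_nonneg (f.1 x * (g.1 x - g.1 y) - g.1 y * (f.1 x - f.1 y))]
      have := mul_le_mul_of_nonneg_left h1 (by positivity : 0 ≤ 2 * A ^ 2)
      have := mul_le_mul_of_nonneg_left h2 (by positivity : 0 ≤ 2 * B ^ 2)
      linarith)
  exact ⟨h, hc, f.2.2.2.mul_right⟩

/-- A sequence of reals that is uniformly approximated by convergent sequences converges. -/
theorem exists_lim_of_approx (s : ℕ → ℝ)
    (h : ∀ ε > 0, ∃ s' : ℕ → ℝ, (∃ L, Tendsto s' atTop (𝓝 L)) ∧ ∀ m, |s m - s' m| ≤ ε) :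
    ∃ L, Tendsto s atTop (𝓝 L) := by
  refine cauchySeq_tendsto_of_complete (Metric.cauchySeq_iff.2 fun ε hε => ?_)
  obtain ⟨s', ⟨L, hL⟩, hs⟩ := h (ε / 4) (by positivity)
  obtain ⟨N, hN⟩ := Metric.cauchySeq_iff.1 hL.cauchySeq (ε / 4) (by positivity)
  refine ⟨N, fun m hm n hn => ?_⟩
  have h1 := hN m hm n hn
  rw [Real.dist_eq] at h1 ⊢
  have h2 := abs_le.1 (hs m)
  have h3 := abs_le.1 (hs n)
  have h4 := abs_lt.1 h1
  rw [abs_lt]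
  constructor <;> linarith

theorem discreteSum_abs_le (m : ℕ) (g₁ g₂ : X → ℝ) (f₁ f₂ : S.core) (A B : ℝ)
    (h₁ : ∀ x, |g₁ x| ≤ A) (h₂ : ∀ x, |g₂ x| ≤ B) (hA : 0 ≤ A) (hB : 0 ≤ B) :
    |S.discreteSum V m (act g₁ (univDeriv f₁.1) * act g₂ (univDeriv f₂.1))|
      ≤ A * B * ((S.energy f₁ + S.energy f₂) / 2) := by
  have e₁ : S.traceEnergy (V.set m) f₁.1 ≤ S.energy f₁ :=
    S.traceEnergy_le (S.toF f₁) fun _ _ => rfl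
  have e₂ : S.traceEnergy (V.set m) f₂.1 ≤ S.energy f₂ :=
    S.traceEnergy_le (S.toF f₂) fun _ _ => rfl
  rw [← S.discreteSum_sq V] at e₁ e₂
  have hpt : ∀ x y, |(act g₁ (univDeriv f₁.1) * act g₂ (univDeriv f₂.1)) x y| ≤
      ((A * B / 2) • (univDeriv f₁.1 * univDeriv f₁.1 + univDeriv f₂.1 * univDeriv f₂.1)) x y := by
    intro x y
    simp only [act, univDeriv, Pi.mul_apply, Pi.add_apply, Pi.smul_apply, smul_eq_mul]
    have i₁ : |(g₁ x + g₁ y) / 2| ≤ A := by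
      have a := abs_le.1 (h₁ x); have b := abs_le.1 (h₁ y)
      rw [abs_le]; constructor <;> linarith
    have i₂ : |(g₂ x + g₂ y) / 2| ≤ B := by
      have a := abs_le.1 (h₂ x); have b := abs_le.1 (h₂ y)
      rw [abs_le]; constructor <;> linarith
    set a := (g₁ x + g₁ y) / 2
    set b := (g₂ x + g₂ y) / 2
    set p := f₁.1 x - f₁.1 y
    set q := f₂.1 x - f₂.1 y
    have e : |a * p * (b * q)| = (|a| * |b|) * (|p| * |q|) := by
      rw [abs_mul, abs_mul, abs_mul]; ring
    rw [e]
    have j₁ : |a| * |b| ≤ A * B := mul_le_mul i₁ i₂ (abs_nonneg _) hA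
    have j₂ : |p| * |q| ≤ (p * p + q * q) / 2 := by
      nlinarith [sq_nonneg (|p| - |q|), abs_mul_abs_self p, abs_mul_abs_self q]
    calc (|a| * |b|) * (|p| * |q|) ≤ (A * B) * ((p * p + q * q) / 2) :=
          mul_le_mul j₁ j₂ (by positivity) (by positivity)
      _ = _ := by ring
  have up := S.discreteSum_mono V m fun x y => (abs_le.1 (hpt x y)).2
  have lo := S.discreteSum_mono V m (φ := (-(A * B / 2)) •
    (univDeriv f₁.1 * univDeriv f₁.1 + univDeriv f₂.1 * univDeriv f₂.1))
    (ψ := act g₁ (univDeriv f₁.1) * act g₂ (univDeriv f₂.1)) fun x y => by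
      have := (abs_le.1 (hpt x y)).1
      simpa using this
  rw [S.discreteSum_smul, S.discreteSum_add] at up lo
  have k := mul_le_mul_of_nonneg_left (add_le_add e₁ e₂) (by positivity : 0 ≤ A * B / 2)
  rw [abs_le]
  constructor <;> linarith

theorem exists_lim_core (g₁ g₂ f₁ f₂ : S.core) :
    ∃ L, Tendsto (fun m => S.discreteSum V m
      (act g₁.1 (univDeriv f₁.1) * act g₂.1 (univDeriv f₂.1))) atTop (𝓝 L) := by
  let M : S.core → S.core → S.core := fun a b => ⟨a.1 * b.1, S.mul_mem_core V a b⟩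
  have T : ∀ a b : S.core, Tendsto (fun m => S.discreteSum V m (univDeriv a.1 * univDeriv b.1))
      atTop (𝓝 (S.E (S.toF a) (S.toF b))) := fun a b =>
    S.tendsto_discreteSum_deriv V (S.toF a) (S.toF b)
  have h := (((((((T g₁ (M g₂ (M f₁ f₂))).add (T g₂ (M g₁ (M f₁ f₂)))).add
    ((T f₁ (M g₁ (M g₂ f₂))).const_mul (-1))).add ((T f₂ (M g₁ (M g₂ f₁))).const_mul (-1))).add
    (T (M g₁ g₂) (M f₁ f₂))).add ((T (M g₁ f₁) (M g₂ f₂)).const_mul (-1))).add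
    ((T (M g₁ f₂) (M g₂ f₁)).const_mul (-1))).const_mul (-(1 / 4 : ℝ))
  refine ⟨_, h.congr fun m => ?_⟩
  simp only [← S.discreteSum_smul, ← S.discreteSum_add]
  congr 1
  ext x y
  simp only [M, act, univDeriv, Pi.mul_apply, Pi.add_apply, Pi.smul_apply, smul_eq_mul]
  ring

theorem act_sub {Y : Type u} (g g' : Y → ℝ) (ω : Y → Y → ℝ) : act (g - g') ω = act g ω - act g' ω := by
  ext x y; simp [act]; ring

theorem discreteSum_sub (m : ℕ) (φ ψ : X → X → ℝ) :
    S.discreteSum V m (φ - ψ) = S.discreteSum V m φ - S.discreteSum V m ψ := by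
  have := S.discreteSum_add V m (φ - ψ) ψ
  rw [sub_add_cancel] at this
  linarith

theorem exists_lim_generators (g₁ g₂ : C_c(X, ℝ)) (f₁ f₂ : S.core) :
    ∃ L, Tendsto (fun m => S.discreteSum V m
      (act g₁ (univDeriv f₁.1) * act g₂ (univDeriv f₂.1))) atTop (𝓝 L) := by
  have hE : 0 ≤ (S.energy f₁ + S.energy f₂) / 2 := by
    have := S.nonneg (S.toF f₁)
    have := S.nonneg (S.toF f₂)
    unfold energy; linarith
  set e := (S.energy f₁ + S.energy f₂) / 2
  have step : ∀ g₁ : S.core, ∃ L, Tendsto (fun m => S.discreteSum V m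
      (act g₁.1 (univDeriv f₁.1) * act g₂ (univDeriv f₂.1))) atTop (𝓝 L) := by
    intro g₁
    obtain ⟨A, hA0, hA⟩ := S.bounded_of_core g₁
    refine exists_lim_of_approx _ fun ε hε => ?_
    have hη : 0 < ε / (A * e + 1) := by positivity
    obtain ⟨k, hkF, hkc, hks, hk⟩ := S.regular g₂ _ hη
    refine ⟨_, S.exists_lim_core V g₁ ⟨k, hkF, hkc, hks⟩ f₁ f₂, fun m => ?_⟩
    rw [← S.discreteSum_sub, ← mul_sub, ← act_sub]
    refine (S.discreteSum_abs_le V m _ _ f₁ f₂ A (ε / (A * e + 1)) hA ?_ hA0 hη.le).trans ?_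
    · intro x; rw [Pi.sub_apply, abs_sub_comm]; exact (hk x).le
    · have : A * (ε / (A * e + 1)) * e = ε * (A * e / (A * e + 1)) := by ring
      rw [this]
      exact mul_le_of_le_one_right hε.le ((div_le_one (by positivity)).2 (by linarith))
  obtain ⟨A, hA0, hA⟩ := bounded_of_Cc g₂
  refine exists_lim_of_approx _ fun ε hε => ?_
  have hη : 0 < ε / (A * e + 1) := by positivity
  obtain ⟨k, hkF, hkc, hks, hk⟩ := S.regular g₁ _ hη
  refine ⟨_, step ⟨k, hkF, hkc, hks⟩, fun m => ?_⟩
  rw [← S.discreteSum_sub, ← sub_mul, ← act_sub]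
  refine (S.discreteSum_abs_le V m _ _ f₁ f₂ (ε / (A * e + 1)) A ?_ hA hη.le hA0).trans ?_
  · intro x; rw [Pi.sub_apply, abs_sub_comm]; exact (hk x).le
  · have : ε / (A * e + 1) * A * e = ε * (A * e / (A * e + 1)) := by ring
    rw [this]
    exact mul_le_of_le_one_right hε.le ((div_le_one (by positivity)).2 (by linarith))

theorem exists_lim_omega {ω η : X → X → ℝ} (hω : ω ∈ S.omega) (hη : η ∈ S.omega) :
    ∃ L, Tendsto (fun m => S.discreteSum V m (ω * η)) atTop (𝓝 L) := by
  have zero : ∃ L, Tendsto (fun m => S.discreteSum V m 0) atTop (𝓝 L) :=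
    ⟨0, by simp [discreteSum]⟩
  induction hω using Submodule.span_induction with
  | zero => simpa using zero
  | add a b _ _ ha hb =>
    obtain ⟨L, hL⟩ := ha
    obtain ⟨L', hL'⟩ := hb
    exact ⟨_, (hL.add hL').congr fun m => by rw [← S.discreteSum_add, add_mul]⟩
  | smul r a _ ha =>
    obtain ⟨L, hL⟩ := ha
    exact ⟨_, (hL.const_mul r).congr fun m => by rw [← S.discreteSum_smul, smul_mul_assoc]⟩
  | mem a ha =>
    obtain ⟨g₁, f₁, rfl⟩ := ha
    induction hη using Submodule.span_induction with
    | zero => simpa using zero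
    | add a b _ _ ha hb =>
      obtain ⟨L, hL⟩ := ha
      obtain ⟨L', hL'⟩ := hb
      exact ⟨_, (hL.add hL').congr fun m => by rw [← S.discreteSum_add, mul_add]⟩
    | smul r a _ ha =>
      obtain ⟨L, hL⟩ := ha
      exact ⟨_, (hL.const_mul r).congr fun m => by rw [← S.discreteSum_smul, mul_smul_comm]⟩
    | mem b hb =>
      obtain ⟨g₂, f₂, rfl⟩ := hb
      exact S.exists_lim_generators V g₁ g₂ f₁ f₂

/-- The semidefinite inner product on `omega`, as the limit of the discrete sums. -/
def omegaInner (ω η : S.omega) : ℝ :=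
  limUnder atTop fun m => S.discreteSum V m (ω.1 * η.1)

theorem tendsto_omegaInner (ω η : S.omega) :
    Tendsto (fun m => S.discreteSum V m (ω.1 * η.1)) atTop (𝓝 (S.omegaInner V ω η)) :=
  tendsto_nhds_limUnder (S.exists_lim_omega V ω.2 η.2)

/-- The space `omega`, to be endowed with the seminorm of `omegaInner`. -/
def OneForm (_V : ExhaustingSequence X) : Type u := S.omega

instance : AddCommGroup (S.OneForm V) := inferInstanceAs (AddCommGroup S.omega)

instance : Module ℝ (S.OneForm V) := inferInstanceAs (Module ℝ S.omega)

/-- The inner product structure given by `omegaInner`. -/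
abbrev oneFormCore : PreInnerProductSpace.Core ℝ (S.OneForm V) where
  inner := S.omegaInner V
  conj_inner_symm ω η := by
    simp only [omegaInner, mul_comm, conj_trivial]
  re_inner_nonneg ω := by
    refine ge_of_tendsto' (S.tendsto_omegaInner V ω ω) fun m => ?_
    have := S.discreteSum_mono V m (φ := 0) (ψ := ω.1 * ω.1) fun x y => mul_self_nonneg _
    simpa [discreteSum] using this
  add_left ω η ζ := by
    refine tendsto_nhds_unique (S.tendsto_omegaInner V (ω + η : S.omega) ζ)
      (((S.tendsto_omegaInner V ω ζ).add (S.tendsto_omegaInner V η ζ)).congr fun m => ?_)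
    rw [← S.discreteSum_add, ← add_mul]; rfl
  smul_left ω η r := by
    refine tendsto_nhds_unique (S.tendsto_omegaInner V (r • ω : S.omega) η)
      (((S.tendsto_omegaInner V ω η).const_mul r).congr fun m => ?_)
    rw [← S.discreteSum_smul, ← smul_mul_assoc]; rfl

instance : SeminormedAddCommGroup (S.OneForm V) :=
  InnerProductSpace.Core.toSeminormedAddCommGroup (c := S.oneFormCore V)

instance : InnerProductSpace ℝ (S.OneForm V) := InnerProductSpace.ofCore (S.oneFormCore V)

/-- The Hilbert space `H` of generalized `L²` vector fields: the completion of `omega`, modulo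
the elements of zero seminorm. -/
abbrev VecField : Type u := UniformSpace.Completion (S.OneForm V)

theorem norm_sq_oneForm (ω : S.OneForm V) : ‖ω‖ ^ 2 = S.omegaInner V ω ω := by
  rw [← real_inner_self_eq_norm_sq]; rfl

theorem univDeriv_mem [ProperSpace X] (f : S.core) :
    univDeriv f.1 ∈ S.omega := by
  obtain ⟨h, h1, -, hs, -⟩ := exists_continuous_one_zero_of_isCompact (s := tsupport f.1)
    (t := ∅) f.2.2.2 isClosed_empty (Set.disjoint_empty _)
  let h2 : C_c(X, ℝ) := ⟨(2 : ℝ) • h, hs.smul_left (f := fun _ => (2 : ℝ))⟩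
  obtain ⟨k, hkF, hkc, hks, hk⟩ := S.regular h2 1 one_pos
  obtain ⟨hχ, -⟩ := S.markov ⟨k, hkF⟩
  let χ : S.core := ⟨_, hχ, S.continuous_of_mem ⟨_, hχ⟩,
    hks.comp_left (g := fun t : ℝ => max 0 (min 1 t)) (by simp)⟩
  have hone : ∀ x, f.1 x ≠ 0 → χ.1 x = 1 := by
    intro x hx
    have e : h2 x = 2 := by
      have : h x = 1 := h1 (subset_tsupport _ hx)
      simp [h2, this]
    have := hk x
    rw [e, abs_lt] at this
    have : 1 ≤ k x := by linarith
    simp [χ, this]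
  have hprod : ∀ x, χ.1 x * f.1 x = f.1 x := by
    intro x
    by_cases hx : f.1 x = 0
    · simp [hx]
    · simp [hone x hx]
  have e : univDeriv f.1 = act (S.toCc f) (univDeriv χ.1) + act (S.toCc χ) (univDeriv f.1) := by
    ext x y
    have a := hprod x
    have b := hprod y
    change f.1 x - f.1 y = (f.1 x + f.1 y) / 2 * (χ.1 x - χ.1 y)
      + (χ.1 x + χ.1 y) / 2 * (f.1 x - f.1 y)
    linear_combination (-1 : ℝ) * a + b
  rw [e]
  exact Submodule.add_mem _ (Submodule.subset_span ⟨_, _, rfl⟩) (Submodule.subset_span ⟨_, _, rfl⟩)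

/-- The universal derivation `d_u f` of `f ∈ F ∩ C_c(X)`, as an element of `omega`. -/
def oneFormOf [ProperSpace X] (f : S.core) : S.OneForm V :=
  (⟨univDeriv f.1, S.univDeriv_mem f⟩ : S.omega)

/-- The derivation `∂ : F ∩ C_c(X) → H`. -/
def grad [ProperSpace X] (f : S.core) : S.VecField V :=
  (S.oneFormOf V f : UniformSpace.Completion (S.OneForm V))

theorem norm_grad_sq [ProperSpace X] (f : S.core) : ‖S.grad V f‖ ^ 2 = S.energy f := by
  rw [grad, UniformSpace.Completion.norm_coe, norm_sq_oneForm]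
  exact tendsto_nhds_unique (S.tendsto_omegaInner V _ _)
    (S.tendsto_discreteSum_deriv V (S.toF f) (S.toF f))

theorem act_mem (V : ExhaustingSequence X) (g : S.core) {ω : X → X → ℝ} (hω : ω ∈ S.omega) :
    act g.1 ω ∈ S.omega := by
  induction hω using Submodule.span_induction with
  | zero =>
    have : act g.1 (0 : X → X → ℝ) = 0 := by ext x y; simp [act]
    rw [this]; exact Submodule.zero_mem _
  | add a b _ _ ha hb =>
    have : act g.1 (a + b) = act g.1 a + act g.1 b := by ext x y; simp [act]; ring
    rw [this]; exact Submodule.add_mem _ ha hb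
  | smul r a _ ha =>
    have : act g.1 (r • a) = r • act g.1 a := by ext x y; simp [act]; ring
    rw [this]; exact Submodule.smul_mem _ r ha
  | mem a ha =>
    obtain ⟨k, f, rfl⟩ := ha
    let gk : C_c(X, ℝ) := S.toCc g * k
    let kf : C_c(X, ℝ) := k * S.toCc f
    let gf : S.core := ⟨g.1 * f.1, S.mul_mem_core V g f⟩
    have e : act g.1 (act k (univDeriv f.1)) = (1 / 2 : ℝ) • (act gk (univDeriv f.1)
        + act k (univDeriv gf.1) - act kf (univDeriv g.1)) := by
      ext x y
      change (g.1 x + g.1 y) / 2 * ((k x + k y) / 2 * (f.1 x - f.1 y)) =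
        1 / 2 * ((g.1 x * k x + g.1 y * k y) / 2 * (f.1 x - f.1 y)
          + (k x + k y) / 2 * (g.1 x * f.1 x - g.1 y * f.1 y)
          - (k x * f.1 x + k y * f.1 y) / 2 * (g.1 x - g.1 y))
      ring
    rw [e]
    exact Submodule.smul_mem _ _ (Submodule.sub_mem _ (Submodule.add_mem _
      (Submodule.subset_span ⟨_, _, rfl⟩) (Submodule.subset_span ⟨_, _, rfl⟩))
      (Submodule.subset_span ⟨_, _, rfl⟩))

/-- The action of `g ∈ F ∩ C_c(X)` on `omega`, as a linear map. -/
def actLinear (g : S.core) : S.OneForm V →ₗ[ℝ] S.OneForm V where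
  toFun ω := (⟨act g.1 ω.1, S.act_mem V g ω.2⟩ : S.omega)
  map_add' ω η := Subtype.ext (by
    ext x y
    change (g.1 x + g.1 y) / 2 * (ω.1 x y + η.1 x y)
      = (g.1 x + g.1 y) / 2 * ω.1 x y + (g.1 x + g.1 y) / 2 * η.1 x y
    ring)
  map_smul' r ω := Subtype.ext (by
    ext x y
    change (g.1 x + g.1 y) / 2 * (r * ω.1 x y) = r * ((g.1 x + g.1 y) / 2 * ω.1 x y)
    ring)

theorem norm_act_le (g : S.core) (A : ℝ) (hA0 : 0 ≤ A) (hA : ∀ x, |g.1 x| ≤ A)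
    (ω : S.OneForm V) : ‖S.actLinear V g ω‖ ≤ A * ‖ω‖ := by
  refine le_of_sq_le_sq ?_ (mul_nonneg hA0 (norm_nonneg _))
  rw [mul_pow, norm_sq_oneForm, norm_sq_oneForm]
  refine le_of_tendsto_of_tendsto' (S.tendsto_omegaInner V _ _)
    ((S.tendsto_omegaInner V ω ω).const_mul (A ^ 2)) fun m => ?_
  rw [← S.discreteSum_smul]
  refine S.discreteSum_mono V m fun x y => ?_
  change (g.1 x + g.1 y) / 2 * ω.1 x y * ((g.1 x + g.1 y) / 2 * ω.1 x y)
    ≤ A ^ 2 * (ω.1 x y * ω.1 x y)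
  have a := abs_le.1 (hA x)
  have b := abs_le.1 (hA y)
  have h : ((g.1 x + g.1 y) / 2) ^ 2 ≤ A ^ 2 :=
    sq_le_sq' (by linarith) (by linarith)
  nlinarith [mul_le_mul_of_nonneg_right h (mul_self_nonneg (ω.1 x y))]

/-- The action `v ↦ g · v` of `g ∈ F ∩ C_c(X)` on the space `H`. -/
def action (g : S.core) : S.VecField V →L[ℝ] S.VecField V :=
  ((S.actLinear V g).mkContinuousOfExistsBound (by
    obtain ⟨A, hA0, hA⟩ := S.bounded_of_core g
    exact ⟨A, S.norm_act_le V g A hA0 hA⟩)).completion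

section Forms

variable [MeasurableSpace X] (μ : Measure X)

/-- The sequence `f_n ∈ F ∩ C_c(X)` is Cauchy with respect to `E` and converges to `u` in
`L²(X, μ)`. -/
def IsApprox (f : ℕ → S.core) (u : Lp ℝ 2 μ) : Prop :=
  Tendsto (fun n => eLpNorm (fun x => (f n).1 x - u x) 2 μ) atTop (𝓝 0) ∧
    ∀ ε > 0, ∃ N, ∀ m ≥ N, ∀ n ≥ N, S.energy (f m - f n) < ε

/-- The domain `D(E)` of the closure of `(E, F ∩ C_c(X))` on `L²(X, μ)`. -/
def domain : Set (Lp ℝ 2 μ) := {u | ∃ f : ℕ → S.core, S.IsApprox μ f u}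

/-- `r` is the value at `(u, v)` of the extension by continuity of `q` from `F ∩ C_c(X)`
to `D(E)`. -/
def IsClosureValue (q : S.core → S.core → ℝ) (u v : Lp ℝ 2 μ) (r : ℝ) : Prop :=
  ∀ f g : ℕ → S.core, S.IsApprox μ f u → S.IsApprox μ g v →
    Tendsto (fun n => q (f n) (g n)) atTop (𝓝 r)

open Classical in
/-- The closure of the bilinear form `q` on `F ∩ C_c(X)`, as a form on `D(E)`
(with the value `0` where the extension by continuity does not exist). -/
def closureForm (q : S.core → S.core → ℝ) (u v : Lp ℝ 2 μ) : ℝ :=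
  if h : ∃ r, S.IsClosureValue μ q u v r then h.choose else 0

/-- The graph of the generator `L` of the form `q` on `D(E)`: the pairs `(u, L u)`, where
`u ∈ D(E)` and `q(u, v) = - ⟨L u, v⟩` for all `v ∈ D(E)`. -/
def generator (q : S.core → S.core → ℝ) : Set (Lp ℝ 2 μ × Lp ℝ 2 μ) :=
  {p | p.1 ∈ S.domain μ ∧ ∀ v ∈ S.domain μ, S.closureForm μ q p.1 v = - inner ℝ p.2 v}

/-- The Hardy condition on `b` with constants `δ` and `γ`. -/
def Hardy [ProperSpace X] (b : S.VecField V) (δ γ : ℝ) : Prop :=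
  0 < δ ∧ 0 ≤ γ ∧
    ∀ g : S.core, ‖S.action V g b‖ ^ 2 ≤ δ * S.energy g + γ * ∫ x, g.1 x ^ 2 ∂μ

/-- Symmetry and uniform ellipticity of `a`, with constants `lam` and `Lam`. -/
def IsUniformlyElliptic (a : S.VecField V →L[ℝ] S.VecField V) (lam Lam : ℝ) : Prop :=
  (∀ v w, inner ℝ (a v) w = inner ℝ v (a w)) ∧ 0 < lam ∧ lam < Lam ∧
    ∀ v, lam * ‖v‖ ^ 2 ≤ inner ℝ (a v) v ∧ inner ℝ (a v) v ≤ Lam * ‖v‖ ^ 2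

/-- The bilinear form `Q(f, g) = ⟨a ∂f, ∂g⟩ - ⟨g · b, ∂f⟩ - ⟨f · b', ∂g⟩ - ⟨c f, g⟩` on
`F ∩ C_c(X)`. -/
def formQ [ProperSpace X] (a : S.VecField V →L[ℝ] S.VecField V) (b b' : S.VecField V)
    (c : X → ℝ) (f g : S.core) : ℝ :=
  inner ℝ (a (S.grad V f)) (S.grad V g) - inner ℝ (S.action V g b) (S.grad V f)
    - inner ℝ (S.action V f b') (S.grad V g) - ∫ x, c x * f.1 x * g.1 x ∂μ

end Forms

end RegularResistanceForm

section Semigroups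

open scoped NNReal

variable {H : Type u} [NormedAddCommGroup H] [InnerProductSpace ℝ H]

/-- A strongly continuous semigroup of contractions. -/
structure IsContractionSemigroup (T : ℝ≥0 → H →L[ℝ] H) : Prop where
  map_zero : T 0 = ContinuousLinearMap.id ℝ H
  map_add : ∀ s t, T (s + t) = (T s).comp (T t)
  norm_le : ∀ t, ‖T t‖ ≤ 1
  continuous : ∀ x, Continuous fun t => T t x

/-- The graph of the infinitesimal generator of a semigroup. -/
def semigroupGenerator (T : ℝ≥0 → H →L[ℝ] H) : Set (H × H) :=
  {p | Tendsto (fun t : ℝ≥0 => (t : ℝ)⁻¹ • (T t p.1 - p.1)) (𝓝[>] 0) (𝓝 p.2)}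

/-- The function `u` on `[0, ∞)` is a solution of the Cauchy problem `u' = L u` on `(0, ∞)`,
`u(0) = u₀`, where `L` is an operator given by its graph. -/
def IsCauchySolution (L : Set (H × H)) (u₀ : H) (u : ℝ → H) : Prop :=
  ContDiffOn ℝ 1 u (Set.Ioi 0) ∧ ContinuousOn u (Set.Ici 0) ∧
    (∀ t > 0, (u t, deriv u t) ∈ L) ∧ u 0 = u₀

/-- The sector condition
`|⟨(-L - ε) f, g⟩| ≤ K ⟨(-L - ε) f, f⟩^(1/2) ⟨(-L - ε) g, g⟩^(1/2)` for `f, g ∈ D(L)` and all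
`0 ≤ ε ≤ ε₀`, where `L` is an operator given by its graph. -/
def SectorCondition (L : Set (H × H)) (ε₀ K : ℝ) : Prop :=
  ∀ ε, 0 ≤ ε → ε ≤ ε₀ → ∀ p ∈ L, ∀ q ∈ L,
    |inner ℝ (-p.2 - ε • p.1) q.1| ≤
      K * √(inner ℝ (-p.2 - ε • p.1) p.1) * √(inner ℝ (-q.2 - ε • q.1) q.1)

end Semigroups

end

/-!
The domain of the closure of `(E, F ∩ C_c(X))` is the closure of the graph `{(f, ∂f)}` in `L² × H`.
The Hardy condition makes `g ↦ g · b` bounded in the graph norm, so `Q` extends to a bounded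
bilinear form there. By the Hardy and Young inequalities `Q(u) ≥ lam₀ E(u) + c₀ ‖u‖²`. Hence the
form remains coercive after subtracting `ε ‖u‖²` with `ε ≤ c₀ / 2`, which gives the sector
condition. Its generator is m-dissipative by Lax-Milgram and so generates a semigroup, the limit of
the exponentials of its Yosida approximations.

For the smoothing estimate let `x` be in the domain of `L²` and `y = L x`. By the sector condition
for `T_s x` and `T_s y`, the function `s² ‖T_s y‖² + K² / 4 ‖T_s x‖²` is nonincreasing in `s`, so
`‖L T_t x‖ ≤ K / (2t) ‖x‖`. This bound extends to all `x` because `L` is closed and the domain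
of `L²` is dense.
-/

noncomputable section

section Contractions

variable {H : Type*} [NormedAddCommGroup H] [NormedSpace ℝ H] {ι : Type*} {l : Filter ι}

theorem equicontinuous_of_norm_apply_le {A : ι → H →L[ℝ] H} (hA : ∀ i x, ‖A i x‖ ≤ ‖x‖) :
    Equicontinuous fun i => (A i : H → H) :=
  (LipschitzWith.uniformEquicontinuous _ 1 fun i =>
    AddMonoidHomClass.lipschitz_of_bound_nnnorm (A i) 1 fun x =>
      (hA i x).trans_eq (one_mul ‖x‖).symm).equicontinuous

theorem tendsto_apply_of_norm_apply_le {A : ι → H →L[ℝ] H} (hA : ∀ i x, ‖A i x‖ ≤ ‖x‖)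
    {x : ι → H} {y z : H} (hx : Tendsto x l (𝓝 y)) (hy : Tendsto (fun i => A i y) l (𝓝 z)) :
    Tendsto (fun i => A i (x i)) l (𝓝 z) := by
  have hdiff : Tendsto (fun i => A i (x i - y)) l (𝓝 0) :=
    squeeze_zero_norm (fun i => hA i _) (tendsto_iff_norm_sub_tendsto_zero.1 hx)
  simpa only [map_sub, sub_add_cancel, zero_add] using hdiff.add hy

theorem cauchySeq_apply_of_dense {A : ℕ → H →L[ℝ] H} (hA : ∀ n x, ‖A n x‖ ≤ ‖x‖) {D : Set H}
    (hD : Dense D) (hc : ∀ x ∈ D, CauchySeq fun n => A n x) (x : H) :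
    CauchySeq fun n => A n x := by
  refine Metric.cauchySeq_iff'.2 fun ε hε => ?_
  obtain ⟨y, hxy, hy⟩ := Metric.dense_iff.1 hD x (ε / 3) (by positivity)
  obtain ⟨N, hN⟩ := Metric.cauchySeq_iff'.1 (hc y hy) (ε / 3) (by positivity)
  have hle (n : ℕ) : dist (A n x) (A n y) ≤ dist x y := by
    simpa only [dist_eq_norm, map_sub] using hA n (x - y)
  refine ⟨N, fun n hn => ?_⟩
  rw [Metric.mem_ball'] at hxy
  calc dist (A n x) (A N x)
      ≤ dist (A n x) (A n y) + dist (A n y) (A N y) + dist (A N y) (A N x) :=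
        dist_triangle4 _ _ _ _
    _ < ε / 3 + ε / 3 + ε / 3 := by
      have hNx := hle N
      rw [dist_comm (A N x)] at hNx
      exact add_lt_add (add_lt_add ((hle n).trans_lt hxy) (hN n hn)) (hNx.trans_lt hxy)
    _ = ε := by ring

end Contractions

section Dissipation

variable {H : Type*} [NormedAddCommGroup H] [InnerProductSpace ℝ H]

theorem norm_le_norm_zero_of_inner_deriv_nonpos {w w' : ℝ → H}
    (hw : ContinuousOn w (Set.Ici 0)) (hd : ∀ s > 0, HasDerivAt w (w' s) s)
    (hn : ∀ s > 0, inner ℝ (w' s) (w s) ≤ 0) {t : ℝ} (ht : 0 ≤ t) : ‖w t‖ ≤ ‖w 0‖ := by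
  have hanti : AntitoneOn (fun s => ‖w s‖ ^ 2) (Set.Ici 0) := by
    refine antitoneOn_of_hasDerivWithinAt_nonpos (convex_Ici 0) (hw.norm.pow 2)
      (f' := fun s => 2 * inner ℝ (w s) (w' s)) ?_ ?_ <;> rw [interior_Ici] <;> intro s hs
    · exact (hd s hs).norm_sq.hasDerivWithinAt
    · rw [real_inner_comm]
      exact mul_nonpos_of_nonneg_of_nonpos zero_le_two (hn s hs)
  exact le_of_sq_le_sq (hanti Set.self_mem_Ici ht ht) (norm_nonneg _)

variable [CompleteSpace H]

theorem hasDerivAt_exp_smul_apply (A : H →L[ℝ] H) (x : H) (t : ℝ) :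
    HasDerivAt (fun s : ℝ => NormedSpace.exp (s • A) x) (NormedSpace.exp (t • A) (A x)) t := by
  simpa using (hasDerivAt_exp_smul_const (𝕂 := ℝ) A t).clm_apply (hasDerivAt_const t x)

theorem norm_exp_smul_apply_le {A : H →L[ℝ] H} (hA : ∀ x, inner ℝ (A x) x ≤ 0) {t : ℝ}
    (ht : 0 ≤ t) (x : H) : ‖NormedSpace.exp (t • A) x‖ ≤ ‖x‖ := by
  have hcomm (s : ℝ) : NormedSpace.exp (s • A) (A x) = A (NormedSpace.exp (s • A) x) :=
    DFunLike.congr_fun ((Commute.refl A).smul_left s).exp_left.eq x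
  have hle := norm_le_norm_zero_of_inner_deriv_nonpos
    (fun s _ => (hasDerivAt_exp_smul_apply A x s).continuousAt.continuousWithinAt)
    (fun s _ => hasDerivAt_exp_smul_apply A x s) (fun s _ => hcomm s ▸ hA _) ht
  simpa using hle

theorem exp_add_smul_apply (A : H →L[ℝ] H) (s t : ℝ) (x : H) :
    NormedSpace.exp ((s + t) • A) x = NormedSpace.exp (s • A) (NormedSpace.exp (t • A) x) := by
  let _ : NormedAlgebra ℚ (H →L[ℝ] H) := NormedAlgebra.restrictScalars ℚ ℝ (H →L[ℝ] H)
  rw [add_smul, NormedSpace.exp_add_of_commute (((Commute.refl A).smul_right t).smul_left s)]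
  rfl

theorem norm_exp_smul_apply_sub_le {A B : H →L[ℝ] H} (hAB : Commute A B)
    (hA : ∀ x, inner ℝ (A x) x ≤ 0) (hB : ∀ x, inner ℝ (B x) x ≤ 0) {t : ℝ} (ht : 0 ≤ t)
    (x : H) :
    ‖NormedSpace.exp (t • A) x - NormedSpace.exp (t • B) x‖ ≤ t * ‖A x - B x‖ := by
  have hd (s : ℝ) : HasDerivAt
      (fun s : ℝ => NormedSpace.exp (s • A) (NormedSpace.exp ((t - s) • B) x))
      (NormedSpace.exp (s • A) (NormedSpace.exp ((t - s) • B) (A x - B x))) s := by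
    have hB' : HasDerivAt (fun s : ℝ => NormedSpace.exp ((t - s) • B) x)
        (-NormedSpace.exp ((t - s) • B) (B x)) s :=
      (hasDerivAt_exp_smul_apply B x (t - s)).comp_const_sub t s
    have hcomm : A (NormedSpace.exp ((t - s) • B) x) = NormedSpace.exp ((t - s) • B) (A x) :=
      DFunLike.congr_fun (hAB.smul_right (t - s)).exp_right.eq x
    convert (hasDerivAt_exp_smul_const (𝕂 := ℝ) A s).clm_apply hB' using 1
    rw [mul_apply_eq_comp, hcomm, map_neg, map_sub, map_sub, sub_eq_add_neg]
  have hle := norm_image_sub_le_of_norm_deriv_le_segment' (a := 0) (b := t)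
    (C := ‖A x - B x‖) (fun s _ => (hd s).hasDerivWithinAt)
    (fun s hs => (norm_exp_smul_apply_le hA hs.1 _).trans
      (norm_exp_smul_apply_le hB (sub_nonneg.2 hs.2.le) _)) t (Set.right_mem_Icc.2 ht)
  simpa [mul_comm] using hle

end Dissipation

/-- An m-dissipative operator, given by its graph: a dissipative operator `L` such that `1 - r L`
is surjective for all `r > 0`. -/
structure MDissipative {H : Type*} [NormedAddCommGroup H] [InnerProductSpace ℝ H]
    (L : Submodule ℝ (H × H)) : Prop where
  inner_nonpos : ∀ p ∈ L, inner ℝ p.2 p.1 ≤ 0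
  exists_sub_smul_eq : ∀ r : ℝ, 0 < r → ∀ x : H, ∃ p ∈ L, p.1 - r • p.2 = x
  eq_zero : ∀ h : H, ((0 : H), h) ∈ L → h = 0

namespace MDissipative

variable {H : Type*} [NormedAddCommGroup H] [InnerProductSpace ℝ H] {L : Submodule ℝ (H × H)}
  (hL : MDissipative L) {r : ℝ} (hr : 0 < r)

include hL hr in
theorem norm_fst_le {p : H × H} (hp : p ∈ L) : ‖p.1‖ ≤ ‖p.1 - r • p.2‖ := by
  refine le_of_sq_le_sq ?_ (norm_nonneg _)
  have hneg := mul_nonpos_of_nonneg_of_nonpos hr.le (hL.inner_nonpos p hp)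
  rw [norm_sub_sq_real, real_inner_smul_right, real_inner_comm]
  nlinarith [sq_nonneg ‖r • p.2‖]

/-- The bijection `p ↦ p.1 - r p.2` of the graph of `L` onto `H`. -/
def resolventEquiv : L ≃ₗ[ℝ] H :=
  LinearEquiv.ofBijective ((LinearMap.fst ℝ H H - r • LinearMap.snd ℝ H H).comp L.subtype) <| by
    refine ⟨(injective_iff_map_eq_zero _).2 fun p hp => ?_, fun x => ?_⟩
    · have hp' : p.1.1 - r • p.1.2 = 0 := hp
      have hfst : p.1.1 = 0 := by simpa [hp'] using hL.norm_fst_le hr p.2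
      exact Subtype.ext (Prod.ext hfst (by simpa [hfst, hr.ne'] using hp'))
    · obtain ⟨p, hp, rfl⟩ := hL.exists_sub_smul_eq r hr x
      exact ⟨⟨p, hp⟩, rfl⟩

/-- The resolvent `(1 - r L)⁻¹`. -/
def resolvent : H →L[ℝ] H :=
  ((LinearMap.fst ℝ H H).comp (L.subtype.comp (hL.resolventEquiv hr).symm.toLinearMap)).mkContinuous
    1 fun x => by
      rw [one_mul]
      conv_rhs => rw [← (hL.resolventEquiv hr).apply_symm_apply x]
      exact hL.norm_fst_le hr ((hL.resolventEquiv hr).symm x).2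

/-- The Yosida approximation `L (1 - r L)⁻¹ = r⁻¹ ((1 - r L)⁻¹ - 1)` of `L`. -/
def yosida : H →L[ℝ] H := r⁻¹ • (hL.resolvent hr - 1)

theorem resolvent_sub_smul_yosida (x : H) : hL.resolvent hr x - r • hL.yosida hr x = x := by
  simp [yosida, smul_inv_smul₀ hr.ne']

theorem resolvent_sub_smul {p : H × H} (hp : p ∈ L) : hL.resolvent hr (p.1 - r • p.2) = p.1 :=
  congrArg (fun q : L => q.1.1) ((hL.resolventEquiv hr).symm_apply_apply ⟨p, hp⟩)

theorem resolvent_yosida_mem (x : H) : (hL.resolvent hr x, hL.yosida hr x) ∈ L := by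
  obtain ⟨p, hp, rfl⟩ := hL.exists_sub_smul_eq r hr x
  have hfst := hL.resolvent_sub_smul hr hp
  have hsnd : hL.yosida hr (p.1 - r • p.2) = p.2 := by
    simp [yosida, hfst, inv_smul_smul₀ hr.ne']
  rwa [hfst, hsnd]

theorem norm_resolvent_le (x : H) : ‖hL.resolvent hr x‖ ≤ ‖x‖ := by
  simpa only [hL.resolvent_sub_smul_yosida] using
    hL.norm_fst_le hr (hL.resolvent_yosida_mem hr x)

theorem yosida_fst {p : H × H} (hp : p ∈ L) : hL.yosida hr p.1 = hL.resolvent hr p.2 := by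
  have h := hL.resolvent_sub_smul hr hp
  rw [map_sub, map_smul, sub_eq_iff_eq_add'] at h
  simp [yosida, h, inv_smul_smul₀ hr.ne']

theorem norm_yosida_fst_le {p : H × H} (hp : p ∈ L) : ‖hL.yosida hr p.1‖ ≤ ‖p.2‖ :=
  hL.yosida_fst hr hp ▸ hL.norm_resolvent_le hr p.2

theorem inner_yosida_nonpos (x : H) : inner ℝ (hL.yosida hr x) x ≤ 0 := by
  have hneg := hL.inner_nonpos _ (hL.resolvent_yosida_mem hr x)
  have hsq := mul_nonneg hr.le (real_inner_self_nonneg (x := hL.yosida hr x))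
  calc inner ℝ (hL.yosida hr x) x
      = inner ℝ (hL.yosida hr x) (hL.resolvent hr x - r • hL.yosida hr x) := by
        rw [hL.resolvent_sub_smul_yosida]
    _ ≤ 0 := by rw [inner_sub_right, real_inner_smul_right]; linarith

theorem map_resolvent_mem {p : H × H} (hp : p ∈ L) :
    (hL.resolvent hr p.1, hL.resolvent hr p.2) ∈ L :=
  hL.yosida_fst hr hp ▸ hL.resolvent_yosida_mem hr p.1

theorem commute_yosida {s : ℝ} (hs : 0 < s) : Commute (hL.yosida hr) (hL.yosida hs) := by
  have hcomm : Commute (hL.resolvent hr) (hL.resolvent hs) := by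
    ext x
    have h := hL.resolvent_sub_smul hs (hL.map_resolvent_mem hr (hL.resolvent_yosida_mem hs x))
    rw [← map_smul, ← map_sub, hL.resolvent_sub_smul_yosida] at h
    exact h.symm
  exact (((hcomm.sub_left (Commute.one_left _)).sub_right (Commute.one_right _)).smul_left
    _).smul_right _

include hL in
theorem isClosed : IsClosed (L : Set (H × H)) := by
  have hset : (L : Set (H × H)) = {p | hL.resolvent one_pos (p.1 - p.2) = p.1} := by
    ext p
    refine ⟨fun hp => by simpa using hL.resolvent_sub_smul one_pos hp, fun hp => ?_⟩
    have hmem := hL.resolvent_yosida_mem one_pos (p.1 - p.2)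
    have hy : hL.yosida one_pos (p.1 - p.2) = p.2 := by simp [yosida, Set.mem_ofPred.1 hp]
    rwa [Set.mem_ofPred.1 hp, hy] at hmem
  rw [hset]
  exact isClosed_eq (by fun_prop) continuous_fst

include hL in
theorem dense_domain [CompleteSpace H] : Dense (Prod.fst '' (L : Set (H × H))) := by
  change Dense (L.map (LinearMap.fst ℝ H H) : Set H)
  rw [Submodule.dense_iff_topologicalClosure_eq_top, Submodule.topologicalClosure_eq_top_iff,
    Submodule.eq_bot_iff]
  intro x hx
  obtain ⟨p, hp, rfl⟩ := hL.exists_sub_smul_eq 1 one_pos x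
  rw [one_smul] at hx ⊢
  have horth : inner ℝ p.1 (p.1 - p.2) = 0 :=
    (Submodule.mem_orthogonal _ _).1 hx p.1 ⟨p, hp, rfl⟩
  rw [inner_sub_right, real_inner_comm p.2] at horth
  have hfst : p.1 = 0 :=
    real_inner_self_nonpos.1 (sub_eq_zero.1 horth ▸ hL.inner_nonpos p hp)
  rw [hfst, hL.eq_zero p.2 (hfst ▸ hp), sub_zero]

theorem tendsto_resolvent [CompleteSpace H] {ι : Type*} {l : Filter ι} {r : ι → ℝ}
    (hr : ∀ i, 0 < r i) (hr0 : Tendsto r l (𝓝 0)) (x : H) :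
    Tendsto (fun i => hL.resolvent (hr i) x) l (𝓝 x) := by
  have hclosed := (equicontinuous_of_norm_apply_le fun i =>
    hL.norm_resolvent_le (hr i)).isClosed_setOfPred_tendsto (l := l) continuous_id
  refine hclosed.closure_subset_iff.2 ?_ (hL.dense_domain x)
  rintro _ ⟨p, hp, rfl⟩
  refine tendsto_iff_norm_sub_tendsto_zero.2 (squeeze_zero (fun _ => norm_nonneg _) (fun i => ?_)
    (by simpa using hr0.mul_const ‖p.2‖))
  have hJ : hL.resolvent (hr i) p.1 - p.1 = r i • hL.yosida (hr i) p.1 := by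
    rw [sub_eq_iff_eq_add, ← sub_eq_iff_eq_add', hL.resolvent_sub_smul_yosida]
  rw [id, hJ, norm_smul, Real.norm_of_nonneg (hr i).le]
  exact mul_le_mul_of_nonneg_left (hL.norm_yosida_fst_le (hr i) hp) (hr i).le

include hL in
theorem dense_domain_sq [CompleteSpace H] : Dense {x | ∃ y z, (x, y) ∈ L ∧ (y, z) ∈ L} := by
  refine Dense.of_closure (hL.dense_domain.mono ?_)
  rintro _ ⟨p, hp, rfl⟩
  have hpos (n : ℕ) : 0 < 1 / ((n : ℝ) + 1) := Nat.one_div_pos_of_nat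
  exact mem_closure_of_tendsto
    (hL.tendsto_resolvent hpos tendsto_one_div_add_atTop_nhds_zero_nat p.1)
    (.of_forall fun n => ⟨_, _, hL.map_resolvent_mem (hpos n) hp, hL.resolvent_yosida_mem _ _⟩)

end MDissipative

section Semigroups

open scoped NNReal

variable {H : Type u} [NormedAddCommGroup H] [InnerProductSpace ℝ H]

theorem IsCauchySolution.norm_sub_le {L : Submodule ℝ (H × H)}
    (hL : ∀ p ∈ L, inner ℝ p.2 p.1 ≤ 0) {x y : H} {u v : ℝ → H}
    (hu : IsCauchySolution (L : Set (H × H)) x u) (hv : IsCauchySolution (L : Set (H × H)) y v)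
    {t : ℝ} (ht : 0 ≤ t) : ‖u t - v t‖ ≤ ‖x - y‖ := by
  have hd {x : H} {w : ℝ → H} (hw : IsCauchySolution (L : Set (H × H)) x w) (s : ℝ) (hs : s > 0) :
      HasDerivAt w (deriv w s) s :=
    ((hw.1.differentiableOn one_ne_zero).differentiableAt (Ioi_mem_nhds hs)).hasDerivAt
  have hle := norm_le_norm_zero_of_inner_deriv_nonpos (w := fun s => u s - v s)
    (hu.2.1.sub hv.2.1) (fun s hs => (hd hu s hs).sub (hd hv s hs))
    (fun s hs => hL _ (L.sub_mem (hu.2.2.1 s hs) (hv.2.2.1 s hs))) ht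
  rwa [hu.2.2.2, hv.2.2.2] at hle

theorem IsCauchySolution.eq {L : Submodule ℝ (H × H)} (hL : ∀ p ∈ L, inner ℝ p.2 p.1 ≤ 0)
    {x : H} {u v : ℝ → H} (hu : IsCauchySolution (L : Set (H × H)) x u)
    (hv : IsCauchySolution (L : Set (H × H)) x v) {t : ℝ} (ht : 0 ≤ t) : u t = v t :=
  sub_eq_zero.1 (norm_le_zero_iff.1 (by simpa using hu.norm_sub_le hL hv ht))

namespace IsContractionSemigroup

variable {T : ℝ≥0 → H →L[ℝ] H} (hT : IsContractionSemigroup T)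
include hT

theorem norm_apply_le (t : ℝ≥0) (x : H) : ‖T t x‖ ≤ ‖x‖ := by
  simpa only [one_mul] using (T t).le_of_opNorm_le (hT.norm_le t) x

theorem zero_apply (x : H) : T 0 x = x := by rw [hT.map_zero, ContinuousLinearMap.id_apply]

theorem add_apply (s t : ℝ≥0) (x : H) : T (s + t) x = T s (T t x) := by
  rw [hT.map_add, ContinuousLinearMap.comp_apply]

theorem toNNReal_apply {s t : ℝ} (hs : 0 ≤ s) (hst : s ≤ t) (x : H) :
    T t.toNNReal x = T (t - s).toNNReal (T s.toNNReal x) := by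
  rw [← hT.add_apply, ← Real.toNNReal_add (sub_nonneg.2 hst) hs, sub_add_cancel]

theorem continuous_toNNReal (x : H) : Continuous fun s : ℝ => T s.toNNReal x :=
  (hT.continuous x).comp continuous_real_toNNReal

theorem inner_generator_nonpos {p : H × H} (hp : p ∈ semigroupGenerator T) :
    inner ℝ p.2 p.1 ≤ 0 := by
  have hlim : Tendsto (fun t : ℝ≥0 => inner ℝ ((t : ℝ)⁻¹ • (T t p.1 - p.1)) p.1) (𝓝[>] 0)
      (𝓝 (inner ℝ p.2 p.1)) := Tendsto.inner hp tendsto_const_nhds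
  refine le_of_tendsto' hlim fun t => ?_
  have hle : inner ℝ (T t p.1) p.1 ≤ ‖p.1‖ * ‖p.1‖ :=
    (real_inner_le_norm _ _).trans (mul_le_mul_of_nonneg_right (hT.norm_apply_le t _)
      (norm_nonneg _))
  rw [real_inner_smul_left, inner_sub_left, real_inner_self_eq_norm_mul_norm]
  exact mul_nonpos_of_nonneg_of_nonpos (by positivity) (sub_nonpos.2 hle)

theorem map_mem_generator (t : ℝ≥0) {p : H × H} (hp : p ∈ semigroupGenerator T) :
    (T t p.1, T t p.2) ∈ semigroupGenerator T := by
  refine (((T t).continuous.tendsto p.2).comp hp).congr fun s => ?_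
  simp only [Function.comp, map_smul, map_sub, ← hT.add_apply, add_comm t s]

theorem hasDerivWithinAt_Ioi {p : H × H} (hp : p ∈ semigroupGenerator T) {t : ℝ} (ht : 0 ≤ t) :
    HasDerivWithinAt (fun s : ℝ => T s.toNNReal p.1) (T t.toNNReal p.2) (Set.Ioi t) t := by
  rw [hasDerivWithinAt_iff_tendsto_slope' Set.self_notMem_Ioi]
  have hsub : Tendsto (fun s : ℝ => (s - t).toNNReal) (𝓝[>] t) (𝓝[>] 0) := by
    refine tendsto_nhdsWithin_iff.2 ⟨?_, ?_⟩
    · have hc : Continuous fun s : ℝ => (s - t).toNNReal := by fun_prop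
      simpa using (hc.tendsto t).mono_left nhdsWithin_le_nhds
    · filter_upwards [self_mem_nhdsWithin] with s hs
      exact Real.toNNReal_pos.2 (sub_pos.2 hs)
  refine ((hT.map_mem_generator t.toNNReal hp).comp hsub).congr' ?_
  filter_upwards [self_mem_nhdsWithin] with s hs
  have hts : t ≤ s := le_of_lt hs
  rw [slope, vsub_eq_sub, Function.comp, Real.coe_toNNReal _ (sub_nonneg.2 hts),
    hT.toNNReal_apply ht hts]

variable [CompleteSpace H]

theorem hasDerivAt_integral (x : H) (t : ℝ) :
    HasDerivAt (fun t => ∫ s in (0 : ℝ)..t, T s.toNNReal x) (T t.toNNReal x) t :=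
  (hT.continuous_toNNReal x).integral_hasStrictDerivAt 0 t |>.hasDerivAt

theorem mem_generator_iff_integral {p : H × H} :
    p ∈ semigroupGenerator T ↔
      ∀ t : ℝ, 0 ≤ t → T t.toNNReal p.1 - p.1 = ∫ s in (0 : ℝ)..t, T s.toNNReal p.2 := by
  refine ⟨fun hp t ht => ?_, fun h => ?_⟩
  · rw [intervalIntegral.integral_eq_sub_of_hasDeriv_right_of_le ht
      (hT.continuous_toNNReal p.1).continuousOn (fun s hs => hT.hasDerivWithinAt_Ioi hp hs.1.le)
      ((hT.continuous_toNNReal p.2).intervalIntegrable _ _), Real.toNNReal_zero, hT.zero_apply]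
  · have hd := hasDerivAt_iff_tendsto_slope.1 (hT.hasDerivAt_integral p.2 0)
    rw [Real.toNNReal_zero, hT.zero_apply] at hd
    have hcoe : Tendsto (fun t : ℝ≥0 => (t : ℝ)) (𝓝[>] 0) (𝓝[≠] 0) :=
      tendsto_nhdsWithin_iff.2 ⟨(NNReal.continuous_coe.tendsto 0).mono_left nhdsWithin_le_nhds,
        eventually_mem_nhdsWithin.mono fun t ht => (NNReal.coe_pos.2 ht).ne'⟩
    refine (hd.comp hcoe).congr fun t => ?_
    simp [slope, ← h t t.2]

theorem hasDerivAt {p : H × H} (hp : p ∈ semigroupGenerator T) {t : ℝ} (ht : 0 < t) :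
    HasDerivAt (fun s : ℝ => T s.toNNReal p.1) (T t.toNNReal p.2) t := by
  refine ((hT.hasDerivAt_integral p.2 t).add_const p.1).congr_of_eventuallyEq ?_
  filter_upwards [lt_mem_nhds ht] with s hs
  rw [← hT.mem_generator_iff_integral.1 hp s hs.le, sub_add_cancel]

theorem hasDerivAt_of_lt {x h : H} {s t : ℝ} (hs : 0 ≤ s) (hst : s < t)
    (hx : (T s.toNNReal x, h) ∈ semigroupGenerator T) :
    HasDerivAt (fun t : ℝ => T t.toNNReal x) (T (t - s).toNNReal h) t := by
  refine ((hT.hasDerivAt hx (sub_pos.2 hst)).comp_sub_const t s).congr_of_eventuallyEq ?_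
  filter_upwards [lt_mem_nhds hst] with r hr
  exact hT.toNNReal_apply hs hr.le x

theorem isCauchySolution {x : H}
    (hx : ∀ t : ℝ, 0 < t → ∃ h, (T t.toNNReal x, h) ∈ semigroupGenerator T) :
    IsCauchySolution (semigroupGenerator T) x fun t => T t.toNNReal x := by
  refine ⟨?_, (hT.continuous_toNNReal x).continuousOn, fun t ht => ?_, ?_⟩
  · rw [← zero_add (1 : WithTop ℕ∞), contDiffOn_succ_iff_deriv_of_isOpen isOpen_Ioi,
      contDiffOn_zero]
    refine ⟨fun t (ht : 0 < t) => ?_, by simp, fun t (ht : 0 < t) => ?_⟩ <;>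
      obtain ⟨h, hh⟩ := hx (t / 2) (half_pos ht)
    · exact (hT.hasDerivAt_of_lt (half_pos ht).le (half_lt_self ht)
        hh).differentiableAt.differentiableWithinAt
    · have hc : Continuous fun r : ℝ => T (r - t / 2).toNNReal h :=
        (hT.continuous_toNNReal h).comp (continuous_sub_right _)
      refine (hc.continuousAt.congr ?_).continuousWithinAt
      filter_upwards [lt_mem_nhds (half_lt_self ht)] with r hr
      exact (hT.hasDerivAt_of_lt (half_pos ht).le hr hh).deriv.symm
  · obtain ⟨h, hh⟩ := hx (t / 2) (half_pos ht)
    rw [(hT.hasDerivAt_of_lt (half_pos ht).le (half_lt_self ht) hh).deriv]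
    simpa only [← hT.toNNReal_apply (half_pos ht).le (half_lt_self ht).le]
      using hT.map_mem_generator (t - t / 2).toNNReal hh
  · simp only [Real.toNNReal_zero, hT.zero_apply]

end IsContractionSemigroup

namespace MDissipative

variable [CompleteSpace H] {L : Submodule ℝ (H × H)} (hL : MDissipative L)

/-- The Yosida approximation of `L` with parameter `1 / (n + 1)`. -/
abbrev yosidaSeq (n : ℕ) : H →L[ℝ] H := hL.yosida (r := 1 / ((n : ℝ) + 1)) Nat.one_div_pos_of_nat

/-- The semigroup of the `n`-th Yosida approximation of `L`. -/
def yosidaExp (n : ℕ) (t : ℝ) : H →L[ℝ] H := NormedSpace.exp (t • hL.yosidaSeq n)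

theorem norm_yosidaExp_apply_le (n : ℕ) {t : ℝ} (ht : 0 ≤ t) (x : H) :
    ‖hL.yosidaExp n t x‖ ≤ ‖x‖ :=
  norm_exp_smul_apply_le (hL.inner_yosida_nonpos _) ht x

theorem hasDerivAt_yosidaExp_apply (n : ℕ) (x : H) (t : ℝ) :
    HasDerivAt (fun s => hL.yosidaExp n s x) (hL.yosidaExp n t (hL.yosidaSeq n x)) t :=
  hasDerivAt_exp_smul_apply _ x t

theorem tendsto_yosidaSeq {p : H × H} (hp : p ∈ L) :
    Tendsto (fun n => hL.yosidaSeq n p.1) atTop (𝓝 p.2) := by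
  simp only [hL.yosida_fst _ hp]
  exact hL.tendsto_resolvent _ tendsto_one_div_add_atTop_nhds_zero_nat p.2

theorem cauchySeq_yosidaExp_apply {t : ℝ} (ht : 0 ≤ t) (x : H) :
    CauchySeq fun n => hL.yosidaExp n t x := by
  refine cauchySeq_apply_of_dense (fun n => hL.norm_yosidaExp_apply_le n ht) hL.dense_domain ?_ x
  rintro _ ⟨p, hp, rfl⟩
  have hA := ((hL.tendsto_yosidaSeq hp).const_smul t).cauchySeq
  refine cauchySeq_iff_tendsto_dist_atTop_0.2 (squeeze_zero (fun _ => dist_nonneg) (fun n => ?_)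
    (cauchySeq_iff_tendsto_dist_atTop_0.1 hA))
  rw [dist_eq_norm, dist_eq_norm, ← smul_sub, norm_smul, Real.norm_of_nonneg ht]
  exact norm_exp_smul_apply_sub_le (hL.commute_yosida _ _) (hL.inner_yosida_nonpos _)
    (hL.inner_yosida_nonpos _) ht _

/-- The semigroup generated by `L`, as the limit of its Yosida approximations. -/
def semigroup (t : ℝ≥0) : H →L[ℝ] H :=
  continuousLinearMapOfTendsto (fun n => hL.yosidaExp n t)
    (tendsto_pi_nhds.2 fun x => (hL.cauchySeq_yosidaExp_apply t.2 x).tendsto_limUnder)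

theorem tendsto_yosidaExp_apply (t : ℝ≥0) (x : H) :
    Tendsto (fun n => hL.yosidaExp n t x) atTop (𝓝 (hL.semigroup t x)) :=
  (hL.cauchySeq_yosidaExp_apply t.2 x).tendsto_limUnder

theorem lipschitzWith_semigroup_apply {p : H × H} (hp : p ∈ L) :
    LipschitzWith ‖p.2‖₊ fun t => hL.semigroup t p.1 := by
  refine LipschitzWith.of_dist_le_mul fun s t => ?_
  refine le_of_tendsto' ((hL.tendsto_yosidaExp_apply s p.1).dist
    (hL.tendsto_yosidaExp_apply t p.1)) fun n => ?_
  rw [dist_eq_norm, NNReal.dist_eq]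
  exact (convex_Ici (0 : ℝ)).norm_image_sub_le_of_norm_hasDerivWithin_le
    (fun r _ => (hL.hasDerivAt_yosidaExp_apply n p.1 r).hasDerivWithinAt)
    (fun r hr => (hL.norm_yosidaExp_apply_le n hr _).trans (hL.norm_yosida_fst_le _ hp)) t.2 s.2

theorem isContractionSemigroup_semigroup : IsContractionSemigroup hL.semigroup := by
  have hle (t : ℝ≥0) (x : H) : ‖hL.semigroup t x‖ ≤ ‖x‖ :=
    le_of_tendsto' (hL.tendsto_yosidaExp_apply t x).norm fun n =>
      hL.norm_yosidaExp_apply_le n t.2 x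
  refine ⟨ContinuousLinearMap.ext fun x => ?_, fun s t => ContinuousLinearMap.ext fun x => ?_,
    fun t => (hL.semigroup t).opNorm_le_bound zero_le_one fun x => by simpa using hle t x,
    fun x => continuous_iff_continuousAt.2 fun t => ?_⟩
  · exact tendsto_nhds_unique (hL.tendsto_yosidaExp_apply 0 x) (by simp [yosidaExp])
  · refine tendsto_nhds_unique (hL.tendsto_yosidaExp_apply (s + t) x) ?_
    simp only [yosidaExp, NNReal.coe_add, exp_add_smul_apply]
    exact tendsto_apply_of_norm_apply_le (fun n => hL.norm_yosidaExp_apply_le n s.2)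
      (hL.tendsto_yosidaExp_apply t x) (hL.tendsto_yosidaExp_apply s _)
  · have hclosed := (equicontinuous_of_norm_apply_le hle).isClosed_setOfPred_tendsto
      (l := 𝓝 t) (hL.semigroup t).continuous
    refine hclosed.closure_subset_iff.2 ?_ (hL.dense_domain x)
    rintro _ ⟨p, hp, rfl⟩
    exact (hL.lipschitzWith_semigroup_apply hp).continuous.tendsto t

theorem semigroup_apply_sub_eq_integral {p : H × H} (hp : p ∈ L) {t : ℝ} (ht : 0 ≤ t) :
    hL.semigroup t.toNNReal p.1 - p.1 = ∫ s in (0 : ℝ)..t, hL.semigroup s.toNNReal p.2 := by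
  have hlim {s : ℝ} (hs : 0 ≤ s) (x : H) :
      Tendsto (fun n => hL.yosidaExp n s x) atTop (𝓝 (hL.semigroup s.toNNReal x)) := by
    simpa only [Real.coe_toNNReal _ hs] using hL.tendsto_yosidaExp_apply s.toNNReal x
  have hcont (n : ℕ) (x : H) : Continuous fun s => hL.yosidaExp n s x :=
    continuous_iff_continuousAt.2 fun s => (hL.hasDerivAt_yosidaExp_apply n x s).continuousAt
  have happrox (n : ℕ) : hL.yosidaExp n t p.1 - p.1 =
      ∫ s in (0 : ℝ)..t, hL.yosidaExp n s (hL.yosidaSeq n p.1) := by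
    rw [intervalIntegral.integral_eq_sub_of_hasDerivAt
      (fun s _ => hL.hasDerivAt_yosidaExp_apply n p.1 s) ((hcont n _).intervalIntegrable _ _)]
    simp [yosidaExp]
  refine tendsto_nhds_unique ((hlim ht p.1).sub_const p.1) ?_
  simp only [happrox]
  refine intervalIntegral.tendsto_integral_filter_of_dominated_convergence (fun _ => ‖p.2‖)
    (.of_forall fun n => (hcont n _).aestronglyMeasurable)
    (.of_forall fun n => .of_forall fun s hs => ?_) intervalIntegrable_const
    (.of_forall fun s hs => ?_) <;> rw [Set.uIoc_of_le ht] at hs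
  · exact (hL.norm_yosidaExp_apply_le n hs.1.le _).trans (hL.norm_yosida_fst_le _ hp)
  · exact tendsto_apply_of_norm_apply_le (fun n => hL.norm_yosidaExp_apply_le n hs.1.le)
      (hL.tendsto_yosidaSeq hp) (hlim hs.1.le p.2)

omit [CompleteSpace H] in
include hL in
theorem eq_semigroupGenerator {T : ℝ≥0 → H →L[ℝ] H} (hT : IsContractionSemigroup T)
    (hsub : (L : Set (H × H)) ⊆ semigroupGenerator T) : semigroupGenerator T = L := by
  refine Set.Subset.antisymm (fun p hp => ?_) hsub
  obtain ⟨q, hq, hqp⟩ := hL.exists_sub_smul_eq 1 one_pos (p.1 - p.2)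
  have hmem : q - p ∈ semigroupGenerator T := by
    refine (Tendsto.sub (hsub hq) hp).congr fun t => ?_
    rw [← smul_sub, Prod.fst_sub, map_sub, sub_sub_sub_comm]
  have hsnd : (q - p).2 = (q - p).1 := by
    rw [one_smul, sub_eq_sub_iff_sub_eq_sub] at hqp
    exact hqp.symm
  have hneg := hT.inner_generator_nonpos hmem
  rw [hsnd] at hneg
  have hfst := real_inner_self_nonpos.1 hneg
  rwa [← sub_eq_zero.1 (Prod.ext hfst (hsnd.trans hfst) : q - p = 0)]

theorem semigroupGenerator_semigroup : semigroupGenerator hL.semigroup = L :=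
  hL.eq_semigroupGenerator hL.isContractionSemigroup_semigroup fun _ hp =>
    hL.isContractionSemigroup_semigroup.mem_generator_iff_integral.2 fun _ ht =>
      hL.semigroup_apply_sub_eq_integral hp ht

include hL in
theorem semigroup_unique {T T' : ℝ≥0 → H →L[ℝ] H} (hT : IsContractionSemigroup T)
    (hT' : IsContractionSemigroup T') (hgen : semigroupGenerator T = L)
    (hgen' : semigroupGenerator T' = L) : T = T' := by
  funext t
  refine DFunLike.coe_injective ((T t).continuous.ext_on hL.dense_domain (T' t).continuous ?_)
  rintro _ ⟨p, hp, rfl⟩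
  have hsol {S : ℝ≥0 → H →L[ℝ] H} (hS : IsContractionSemigroup S)
      (hgenS : semigroupGenerator S = L) :
      IsCauchySolution (L : Set (H × H)) p.1 fun t => S t.toNNReal p.1 :=
    hgenS ▸ hS.isCauchySolution fun t _ => ⟨_, hS.map_mem_generator t.toNNReal (hgenS.symm ▸ hp)⟩
  simpa using (hsol hT hgen).eq hL.inner_nonpos (hsol hT' hgen') t.2

include hL in
theorem existsUnique_semigroup :
    ∃! T : ℝ≥0 → H →L[ℝ] H, IsContractionSemigroup T ∧ semigroupGenerator T = L :=
  ⟨hL.semigroup, ⟨hL.isContractionSemigroup_semigroup, hL.semigroupGenerator_semigroup⟩,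
    fun _ hT => hL.semigroup_unique hT.1 hL.isContractionSemigroup_semigroup hT.2
      hL.semigroupGenerator_semigroup⟩

end MDissipative

namespace SectorCondition

variable {L : Set (H × H)} {ε₀ K : ℝ} (hsec : SectorCondition L ε₀ K)
include hsec

theorem abs_inner_le (hε₀ : 0 ≤ ε₀) {p q : H × H} (hp : p ∈ L) (hq : q ∈ L) :
    |inner ℝ p.2 q.1| ≤ K * √(-inner ℝ p.2 p.1) * √(-inner ℝ q.2 q.1) := by
  simpa only [zero_smul, sub_zero, inner_neg_left, abs_neg] using hsec 0 le_rfl hε₀ p hp q hq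

/-- The left-hand side is the time derivative of `s² ‖T s y‖² + K² / 4 ‖T s x‖²` in terms of
`x`, `y`, `z` in place of `T s x`, `T s y`, `T s z`. -/
theorem lyapunov_deriv_nonpos (hε₀ : 0 ≤ ε₀) (hL : ∀ p ∈ L, inner ℝ p.2 p.1 ≤ 0) {x y z : H}
    (hxy : (x, y) ∈ L) (hyz : (y, z) ∈ L) {s : ℝ} (hs : 0 ≤ s) :
    2 * s * ‖y‖ ^ 2 + s ^ 2 * (2 * inner ℝ y z) + K ^ 2 / 4 * (2 * inner ℝ x y) ≤ 0 := by
  have hx := Real.sq_sqrt (neg_nonneg.2 (hL _ hxy))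
  have hy := Real.sq_sqrt (neg_nonneg.2 (hL _ hyz))
  have hle : ‖y‖ ^ 2 ≤ K * √(-inner ℝ y x) * √(-inner ℝ z y) := by
    rw [← real_inner_self_eq_norm_sq]
    exact (le_abs_self _).trans (hsec.abs_inner_le hε₀ hxy hyz)
  rw [real_inner_comm z y, real_inner_comm y x]
  nlinarith [sq_nonneg (2 * s * √(-inner ℝ z y) - K * √(-inner ℝ y x)),
    mul_le_mul_of_nonneg_left hle hs]

end SectorCondition

namespace IsContractionSemigroup

variable [CompleteSpace H] {T : ℝ≥0 → H →L[ℝ] H} (hT : IsContractionSemigroup T) {ε₀ K : ℝ}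
include hT

theorem norm_generator_le (hsec : SectorCondition (semigroupGenerator T) ε₀ K) (hε₀ : 0 ≤ ε₀)
    (hK : 0 ≤ K) {x y z : H} (hxy : (x, y) ∈ semigroupGenerator T)
    (hyz : (y, z) ∈ semigroupGenerator T) {t : ℝ} (ht : 0 < t) :
    ‖T t.toNNReal y‖ ≤ K / 2 / t * ‖x‖ := by
  have hder (s : ℝ) (hs : 0 < s) : HasDerivAt
      (fun s : ℝ => s ^ 2 * ‖T s.toNNReal y‖ ^ 2 + K ^ 2 / 4 * ‖T s.toNNReal x‖ ^ 2)
      (2 * s * ‖T s.toNNReal y‖ ^ 2 + s ^ 2 * (2 * inner ℝ (T s.toNNReal y) (T s.toNNReal z)) +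
        K ^ 2 / 4 * (2 * inner ℝ (T s.toNNReal x) (T s.toNNReal y))) s := by
    simpa only [Nat.cast_ofNat, Nat.add_one_sub_one, pow_one] using ((hasDerivAt_pow 2 s).fun_mul
      (hT.hasDerivAt hyz hs).norm_sq).fun_add ((hT.hasDerivAt hxy hs).norm_sq.const_mul (K ^ 2 / 4))
  have hanti : AntitoneOn
      (fun s : ℝ => s ^ 2 * ‖T s.toNNReal y‖ ^ 2 + K ^ 2 / 4 * ‖T s.toNNReal x‖ ^ 2)
      (Set.Ici 0) := by
    have hcont := ((continuous_pow 2).mul ((hT.continuous_toNNReal y).norm.pow 2)).add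
      (((hT.continuous_toNNReal x).norm.pow 2).const_mul (K ^ 2 / 4))
    refine antitoneOn_of_hasDerivWithinAt_nonpos (convex_Ici 0) hcont.continuousOn
      (fun s hs => (hder s (Set.mem_Ioi.1 (interior_Ici.subset hs))).hasDerivWithinAt)
      fun s hs => ?_
    rw [interior_Ici] at hs
    exact hsec.lyapunov_deriv_nonpos hε₀ (fun _ => hT.inner_generator_nonpos)
      (hT.map_mem_generator s.toNNReal hxy) (hT.map_mem_generator s.toNNReal hyz)
      hs.le
  have hle := hanti Set.self_mem_Ici ht.le ht.le
  simp only [Real.toNNReal_zero, hT.zero_apply] at hle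
  have hsq : (t * ‖T t.toNNReal y‖) ^ 2 ≤ (K / 2 * ‖x‖) ^ 2 := by
    nlinarith [sq_nonneg (K * ‖T t.toNNReal x‖)]
  rw [div_mul_eq_mul_div, le_div_iff₀' ht]
  exact le_of_sq_le_sq hsq (by positivity)

theorem exists_mem_generator_norm_le (hsec : SectorCondition (semigroupGenerator T) ε₀ K)
    (hε₀ : 0 ≤ ε₀) (hK : 0 ≤ K) {L : Submodule ℝ (H × H)} (hL : MDissipative L)
    (hgen : semigroupGenerator T = L) (x : H) {t : ℝ} (ht : 0 < t) :
    ∃ h, (T t.toNNReal x, h) ∈ semigroupGenerator T ∧ ‖h‖ ≤ K / 2 / t * ‖x‖ := by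
  obtain ⟨u, hu, hux⟩ := mem_closure_iff_seq_limit.1 (hL.dense_domain_sq x)
  choose y z hy hz using hu
  rw [hgen] at hsec ⊢
  have hbound {x y z : H} (hxy : (x, y) ∈ L) (hyz : (y, z) ∈ L) :
      ‖T t.toNNReal y‖ ≤ K / 2 / t * ‖x‖ :=
    hT.norm_generator_le (hgen ▸ hsec) hε₀ hK (hgen.symm.subset hxy) (hgen.symm.subset hyz) ht
  have hcauchy : CauchySeq fun n => T t.toNNReal (y n) := by
    have hlim := (cauchySeq_iff_tendsto_dist_atTop_0.1 hux.cauchySeq).const_mul (K / 2 / t)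
    rw [mul_zero] at hlim
    refine cauchySeq_iff_tendsto_dist_atTop_0.2 (squeeze_zero (fun _ => dist_nonneg) (fun n => ?_)
      hlim)
    rw [dist_eq_norm, dist_eq_norm, ← map_sub]
    exact hbound (L.sub_mem (hy n.1) (hy n.2)) (L.sub_mem (hz n.1) (hz n.2))
  obtain ⟨h, hh⟩ := cauchySeq_tendsto_of_complete hcauchy
  refine ⟨h, hL.isClosed.mem_of_tendsto ((((T t.toNNReal).continuous.tendsto x).comp
    hux).prodMk_nhds hh) (.of_forall fun n => ?_),
    le_of_tendsto_of_tendsto' hh.norm (hux.norm.const_mul _) fun n => hbound (hy n) (hz n)⟩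
  exact hgen.subset (hT.map_mem_generator _ (hgen.symm.subset (hy n)))

theorem neg_inner_generator_le (hsec : SectorCondition (semigroupGenerator T) ε₀ K)
    (hε₀ : 0 ≤ ε₀) (hK : 0 ≤ K) {L : Submodule ℝ (H × H)} (hL : MDissipative L)
    (hgen : semigroupGenerator T = L) (x : H) {t : ℝ} (ht : 0 < t) {h : H}
    (hh : (T t.toNNReal x, h) ∈ semigroupGenerator T) :
    -inner ℝ h (T t.toNNReal x) ≤ K / 2 / t * ‖x‖ ^ 2 := by
  obtain ⟨h', hh', hle⟩ := hT.exists_mem_generator_norm_le hsec hε₀ hK hL hgen x ht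
  obtain rfl := tendsto_nhds_unique hh hh'
  calc -inner ℝ h (T t.toNNReal x)
      ≤ ‖h‖ * ‖T t.toNNReal x‖ := (neg_le_abs _).trans (abs_real_inner_le_norm _ _)
    _ ≤ K / 2 / t * ‖x‖ * ‖x‖ :=
      mul_le_mul hle (hT.norm_apply_le _ _) (norm_nonneg _) (by positivity)
    _ = K / 2 / t * ‖x‖ ^ 2 := by ring

end IsContractionSemigroup

end Semigroups

section CoerciveForms

variable {W : Type*} [NormedAddCommGroup W] [InnerProductSpace ℝ W]

/-- The bounded bilinear form `(w, v) ↦ ⟨A w, C v⟩`. -/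
def innerComp {H : Type*} [NormedAddCommGroup H] [InnerProductSpace ℝ H] (A C : W →L[ℝ] H) :
    W →L[ℝ] W →L[ℝ] ℝ :=
  (isBoundedBilinearMap_inner (𝕜 := ℝ) (E := H)).toContinuousLinearMap.bilinearComp A C

theorem innerComp_apply {H : Type*} [NormedAddCommGroup H] [InnerProductSpace ℝ H]
    (A C : W →L[ℝ] H) (w v : W) : innerComp A C w v = inner ℝ (A w) (C v) := rfl

theorem abs_apply_le_sqrt_mul_sqrt {A : W →L[ℝ] W →L[ℝ] ℝ} {m M : ℝ} (hm : 0 < m)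
    (hM : ‖A‖ ≤ M) (hA : ∀ w, m * ‖w‖ ^ 2 ≤ A w w) (w z : W) :
    |A w z| ≤ M / m * √(A w w) * √(A z z) := by
  have hsqrt (w : W) : √m * ‖w‖ ≤ √(A w w) :=
    Real.le_sqrt_of_sq_le (by rw [mul_pow, Real.sq_sqrt hm.le]; exact hA w)
  have hM₀ : 0 ≤ M := (norm_nonneg A).trans hM
  calc |A w z| ≤ M * ‖w‖ * ‖z‖ := (A.le_opNorm₂ w z).trans (by gcongr)
    _ = M / m * (√m * ‖w‖) * (√m * ‖z‖) := by
      field_simp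
      rw [Real.sq_sqrt hm.le]
    _ ≤ M / m * √(A w w) * √(A z z) := by gcongr <;> exact hsqrt _

variable {H : Type u} [NormedAddCommGroup H] [InnerProductSpace ℝ H]

/-- The graph of the operator on `H` associated with the bounded form `B` on `W`, where `W` is
mapped to `H` by `J`: it relates `J w` to `h` if `B w v = -⟨h, J v⟩` for all `v`. -/
def formGenerator (B : W →L[ℝ] W →L[ℝ] ℝ) (J : W →L[ℝ] H) : Submodule ℝ (H × H) where
  carrier := {p | ∃ w, J w = p.1 ∧ ∀ v, B w v = -inner ℝ p.2 (J v)}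
  zero_mem' := ⟨0, by simp⟩
  add_mem' := by
    rintro p q ⟨w, hw, hp⟩ ⟨z, hz, hq⟩
    refine ⟨w + z, by simp [hw, hz], fun v => ?_⟩
    rw [map_add, add_apply, hp, hq, Prod.snd_add, inner_add_left, neg_add]
  smul_mem' := by
    rintro r p ⟨w, hw, hp⟩
    refine ⟨r • w, by simp [hw], fun v => ?_⟩
    rw [map_smul, smul_apply, hp, Prod.smul_snd, real_inner_smul_left, smul_eq_mul, mul_neg]

variable {B : W →L[ℝ] W →L[ℝ] ℝ} {J : W →L[ℝ] H}

theorem mDissipative_formGenerator [CompleteSpace W] {m : ℝ} (hm : 0 < m)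
    (hB : ∀ w, m * ‖w‖ ^ 2 ≤ B w w) (hJ : Function.Injective J) (hd : DenseRange J) :
    MDissipative (formGenerator B J) where
  inner_nonpos := by
    rintro p ⟨w, hw, hp⟩
    have hpos : 0 ≤ m * ‖w‖ ^ 2 := by positivity
    rw [← hw, ← neg_nonneg, ← hp]
    exact hpos.trans (hB w)
  exists_sub_smul_eq := by
    intro r hr x
    have hc : IsCoercive (r • B + innerComp J J) := by
      refine ⟨r * m, mul_pos hr hm, fun w => ?_⟩
      calc r * m * ‖w‖ * ‖w‖ = r * (m * ‖w‖ ^ 2) := by ring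
        _ ≤ r * B w w := mul_le_mul_of_nonneg_left (hB w) hr.le
        _ ≤ r * B w w + inner ℝ (J w) (J w) := le_add_of_nonneg_right real_inner_self_nonneg
    let w := hc.continuousLinearEquivOfBilin.symm
      ((InnerProductSpace.toDual ℝ W).symm ((innerSL ℝ x).comp J))
    have hw (v : W) : r * B w v + inner ℝ (J w) (J v) = inner ℝ x (J v) := by
      have h := hc.continuousLinearEquivOfBilin_apply w v
      rw [ContinuousLinearEquiv.apply_symm_apply, InnerProductSpace.toDual_symm_apply] at h
      exact h.symm
    refine ⟨(J w, r⁻¹ • (J w - x)), ⟨w, rfl, fun v => ?_⟩, by simp [smul_inv_smul₀ hr.ne']⟩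
    rw [real_inner_smul_left, inner_sub_left, ← hw v]
    field_simp
    ring
  eq_zero := by
    rintro h ⟨w, hw, hh⟩
    obtain rfl : w = 0 := hJ (hw.trans (map_zero J).symm)
    refine hd.eq_zero_of_inner_left ℝ fun v => ?_
    rw [← neg_eq_zero, ← hh, map_zero, zero_apply]

theorem sectorCondition_formGenerator {m ε₀ : ℝ} (hm : 0 < m)
    (hB : ∀ w, m * ‖w‖ ^ 2 + ε₀ * ‖J w‖ ^ 2 ≤ B w w) :
    ∃ K, 0 < K ∧ SectorCondition (formGenerator B J : Set (H × H)) ε₀ K := by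
  refine ⟨(‖B‖ + |ε₀| * ‖innerComp J J‖ + 1) / m, by positivity, ?_⟩
  rintro ε hε hε₀ ⟨_, h⟩ ⟨w, rfl, hw⟩ ⟨_, k⟩ ⟨z, rfl, hz⟩
  have hshift {h : H} {w : W} (hw : ∀ v, B w v = -inner ℝ h (J v)) (v : W) :
      inner ℝ (-h - ε • J w) (J v) = (B - ε • innerComp J J) w v := by
    rw [inner_sub_left, inner_neg_left, real_inner_smul_left, ← hw]
    rfl
  have hnorm : ‖B - ε • innerComp J J‖ ≤ ‖B‖ + |ε₀| * ‖innerComp J J‖ + 1 := by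
    have hle := mul_le_mul_of_nonneg_right (hε₀.trans (le_abs_self _)) (norm_nonneg (innerComp J J))
    have hsmul := (innerComp J J).opNorm_smul_le ε
    rw [Real.norm_of_nonneg hε] at hsmul
    linarith [norm_sub_le B (ε • innerComp J J)]
  have hcoercive (v : W) : m * ‖v‖ ^ 2 ≤ (B - ε • innerComp J J) v v := by
    have hle := mul_le_mul_of_nonneg_right hε₀ (sq_nonneg ‖J v‖)
    have hself : (B - ε • innerComp J J) v v = B v v - ε * ‖J v‖ ^ 2 := by
      rw [← real_inner_self_eq_norm_sq]
      rfl
    linarith [hB v]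
  simp only [hshift hw, hshift hz]
  exact abs_apply_le_sqrt_mul_sqrt hm hnorm hcoercive w z

end CoerciveForms

section GraphClosure

variable {D H V : Type*} [AddCommGroup D] [Module ℝ D]
  [NormedAddCommGroup H] [InnerProductSpace ℝ H]
  [NormedAddCommGroup V] [InnerProductSpace ℝ V]

/-- The graph map `f ↦ (j f, d f)` of the operator `j f ↦ d f`. -/
def graphMap (j : D →ₗ[ℝ] H) (d : D →ₗ[ℝ] V) : D →ₗ[ℝ] WithLp 2 (H × V) :=
  (WithLp.linearEquiv 2 ℝ (H × V)).symm.toLinearMap ∘ₗ j.prod d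

/-- The closure of the graph of the operator `j f ↦ d f`. Its norm is the graph norm, and if the
operator is closable, it stands for the domain of the closure. -/
abbrev GraphClosure (j : D →ₗ[ℝ] H) (d : D →ₗ[ℝ] V) : Submodule ℝ (WithLp 2 (H × V)) :=
  (graphMap j d).range.topologicalClosure

variable {j : D →ₗ[ℝ] H} {d : D →ₗ[ℝ] V}

variable (j d) in
/-- The graph map into the closure of its range. -/
def toGraphClosure : D →ₗ[ℝ] GraphClosure j d :=
  (graphMap j d).codRestrict _ fun f =>
    Submodule.le_topologicalClosure _ (LinearMap.mem_range_self _ f)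

/-- The inclusion of the domain of the closure, `(u, v) ↦ u`. -/
def graphFst : GraphClosure j d →L[ℝ] H :=
  (WithLp.fstL 2 ℝ H V).comp (GraphClosure j d).subtypeL

/-- The closure of the operator `j f ↦ d f`, `(u, v) ↦ v`. -/
def graphSnd : GraphClosure j d →L[ℝ] V :=
  (WithLp.sndL 2 ℝ H V).comp (GraphClosure j d).subtypeL

theorem graphFst_toGraphClosure (f : D) : graphFst (toGraphClosure j d f) = j f := rfl

theorem graphSnd_toGraphClosure (f : D) : graphSnd (toGraphClosure j d f) = d f := rfl

theorem norm_graphClosure_sq (w : GraphClosure j d) :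
    ‖w‖ ^ 2 = ‖graphFst w‖ ^ 2 + ‖graphSnd w‖ ^ 2 :=
  WithLp.prod_norm_sq_eq_of_L2 w.1

theorem min_mul_norm_sq_add_le (m κ : ℝ) (w : GraphClosure j d) :
    min m (κ / 2) * ‖w‖ ^ 2 + κ / 2 * ‖graphFst w‖ ^ 2 ≤
      m * ‖graphSnd w‖ ^ 2 + κ * ‖graphFst w‖ ^ 2 := by
  have hfst := mul_le_mul_of_nonneg_right (min_le_right m (κ / 2)) (sq_nonneg ‖graphFst w‖)
  have hsnd := mul_le_mul_of_nonneg_right (min_le_left m (κ / 2)) (sq_nonneg ‖graphSnd w‖)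
  rw [norm_graphClosure_sq]
  linarith

theorem norm_toGraphClosure_le (f : D) : ‖toGraphClosure j d f‖ ≤ ‖j f‖ + ‖d f‖ := by
  refine le_of_sq_le_sq ?_ (by positivity)
  rw [norm_graphClosure_sq, graphFst_toGraphClosure, graphSnd_toGraphClosure]
  nlinarith [norm_nonneg (j f), norm_nonneg (d f)]

theorem denseRange_toGraphClosure : DenseRange (toGraphClosure j d) := by
  intro w
  rw [Topology.IsEmbedding.subtypeVal.closure_eq_preimage_closure_image, Set.mem_preimage,
    ← Set.range_comp]
  exact w.2

theorem exists_tendsto_toGraphClosure (w : GraphClosure j d) :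
    ∃ f : ℕ → D, Tendsto (fun n => toGraphClosure j d (f n)) atTop (𝓝 w) := by
  obtain ⟨x, hx, hlim⟩ := mem_closure_iff_seq_limit.1 (denseRange_toGraphClosure w)
  choose f hf using hx
  exact ⟨f, by simpa only [hf] using hlim⟩

theorem cauchySeq_toGraphClosure {f : ℕ → D} (hj : CauchySeq fun n => j (f n))
    (hd : CauchySeq fun n => d (f n)) : CauchySeq fun n => toGraphClosure j d (f n) := by
  rw [cauchySeq_iff_tendsto_dist_atTop_0] at hj hd ⊢
  refine squeeze_zero (fun _ => dist_nonneg) (fun n => ?_)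
    (by simpa only [add_zero] using hj.add hd)
  simpa only [dist_eq_norm, map_sub] using
    norm_toGraphClosure_le (j := j) (d := d) (f n.1 - f n.2)

theorem injective_graphFst
    (hclosable : ∀ f : ℕ → D, Tendsto (fun n => j (f n)) atTop (𝓝 0) →
      CauchySeq (fun n => d (f n)) → Tendsto (fun n => d (f n)) atTop (𝓝 0)) :
    Function.Injective (graphFst : GraphClosure j d → H) := by
  refine (injective_iff_map_eq_zero _).2 fun w hw => ?_
  obtain ⟨f, hf⟩ := exists_tendsto_toGraphClosure w
  have hjf : Tendsto (fun n => j (f n)) atTop (𝓝 0) :=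
    hw ▸ (graphFst.continuous.tendsto w).comp hf
  have hdf : Tendsto (fun n => d (f n)) atTop (𝓝 (graphSnd w)) :=
    (graphSnd.continuous.tendsto w).comp hf
  have hsnd : graphSnd w = 0 := tendsto_nhds_unique hdf (hclosable f hjf hdf.cauchySeq)
  simpa [hw, hsnd] using norm_graphClosure_sq w

theorem denseRange_graphFst (hj : DenseRange j) :
    DenseRange (graphFst : GraphClosure j d → H) :=
  hj.mono (Set.range_subset_iff.2 fun f => ⟨toGraphClosure j d f, rfl⟩)

end GraphClosure

namespace RegularResistanceForm

variable {X : Type u} [MetricSpace X] (S : RegularResistanceForm X) (V : ExhaustingSequence X)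

/-- The derivation `∂` as a linear map. -/
def gradLinear [ProperSpace X] : S.core →ₗ[ℝ] S.VecField V where
  toFun := S.grad V
  map_add' f g := by
    rw [grad, grad, grad, ← UniformSpace.Completion.coe_add]
    refine congrArg _ (Subtype.ext ?_)
    ext x y
    exact add_sub_add_comm (f.1 x) (g.1 x) (f.1 y) (g.1 y)
  map_smul' r f := by
    rw [grad, grad, RingHom.id_apply, ← UniformSpace.Completion.coe_smul]
    refine congrArg _ (Subtype.ext ?_)
    ext x y
    exact (mul_sub r (f.1 x) (f.1 y)).symm

theorem norm_gradLinear_sq [ProperSpace X] (f : S.core) :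
    ‖S.gradLinear V f‖ ^ 2 = S.energy f := S.norm_grad_sq V f

theorem action_coe (g : S.core) (ω : S.OneForm V) :
    S.action V g (ω : S.VecField V) = (S.actLinear V g ω : S.VecField V) :=
  UniformSpace.Completion.map_coe (ContinuousLinearMap.uniformContinuous _) ω

/-- The product `g ↦ g · v` with a fixed vector field, as a linear map. -/
def actionLinear (v : S.VecField V) : S.core →ₗ[ℝ] S.VecField V where
  toFun g := S.action V g v
  map_add' f g := by
    induction v using UniformSpace.Completion.induction_on with
    | hp =>
      exact isClosed_eq (S.action V (f + g)).continuous (S.action V f + S.action V g).continuous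
    | ih ω =>
      rw [action_coe, action_coe, action_coe, ← UniformSpace.Completion.coe_add]
      refine congrArg _ (Subtype.ext ?_)
      ext x y
      change (f.1 x + g.1 x + (f.1 y + g.1 y)) / 2 * ω.1 x y
        = (f.1 x + f.1 y) / 2 * ω.1 x y + (g.1 x + g.1 y) / 2 * ω.1 x y
      ring
  map_smul' r f := by
    rw [RingHom.id_apply]
    induction v using UniformSpace.Completion.induction_on with
    | hp => exact isClosed_eq (S.action V (r • f)).continuous (r • S.action V f).continuous
    | ih ω =>
      rw [action_coe, action_coe, ← UniformSpace.Completion.coe_smul]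
      refine congrArg _ (Subtype.ext ?_)
      ext x y
      change (r * f.1 x + r * f.1 y) / 2 * ω.1 x y = r * ((f.1 x + f.1 y) / 2 * ω.1 x y)
      ring

theorem exists_core_eq_one [ProperSpace X] {K : Set X} (hK : IsCompact K) :
    ∃ χ : S.core, (∀ x ∈ K, χ.1 x = 1) ∧ ∀ x, |χ.1 x| ≤ 1 := by
  obtain ⟨φ, hφ, -, hsupp, -⟩ := exists_continuous_one_zero_of_isCompact (s := K)
    (t := ∅) hK isClosed_empty (Set.disjoint_empty _)
  let φ₂ : C_c(X, ℝ) := ⟨(2 : ℝ) • φ, hsupp.smul_left (f := fun _ => (2 : ℝ))⟩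
  -- An approximation of `2` up to `1` is at least `1`, so its truncation to `[0, 1]` equals `1`.
  obtain ⟨k, hkF, -, hksupp, hk⟩ := S.regular φ₂ 1 one_pos
  obtain ⟨hχ, -⟩ := S.markov ⟨k, hkF⟩
  refine ⟨⟨_, hχ, S.continuous_of_mem ⟨_, hχ⟩,
    hksupp.comp_left (g := fun t : ℝ => max 0 (min 1 t)) (by simp)⟩, fun x hx => ?_, fun x => ?_⟩
  · have hφ₂ : φ₂ x = 2 := by
      change 2 * φ x = 2
      rw [hφ hx, Pi.one_apply, mul_one]
    have hdist := hk x
    rw [hφ₂, abs_lt] at hdist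
    have hone : 1 ≤ k x := by linarith
    simp [hone]
  · change |max 0 (min 1 (k x))| ≤ 1
    rw [abs_of_nonneg (le_max_left _ _)]
    exact max_le zero_le_one (min_le_left _ _)

theorem exists_core_dist_le [ProperSpace X] (V : ExhaustingSequence X) (g : C_c(X, ℝ)) :
    ∃ K : Set X, IsCompact K ∧ Function.support g ⊆ K ∧ ∀ ε > 0, ∃ k : S.core,
      Function.support k.1 ⊆ K ∧ ∀ x, dist (k.1 x) (g x) ≤ ε := by
  obtain ⟨χ, hχ, hχ_le⟩ := S.exists_core_eq_one g.hasCompactSupport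
  have hχ_supp (x : X) (hx : x ∈ Function.support g) : χ.1 x = 1 := hχ x (subset_tsupport _ hx)
  refine ⟨tsupport χ.1, χ.2.2.2, fun x hx => subset_tsupport _ ?_, fun ε hε => ?_⟩
  · simp [hχ_supp x hx]
  obtain ⟨f, hfF, hf, hf_supp, hfg⟩ := S.regular g ε hε
  refine ⟨⟨_, S.mul_mem_core V χ ⟨f, hfF, hf, hf_supp⟩⟩,
    (Function.support_mul_subset_left _ _).trans (subset_tsupport _), fun x => ?_⟩
  have hfactor : χ.1 x * f x - g x = χ.1 x * (f x - g x) := by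
    by_cases hx : g x = 0
    · rw [hx, sub_zero, sub_zero]
    · rw [hχ_supp x hx, one_mul, one_mul]
  calc |χ.1 x * f x - g x| = |χ.1 x| * |f x - g x| := by rw [hfactor, abs_mul]
    _ ≤ 1 * ε := mul_le_mul (hχ_le x) (hfg x).le (abs_nonneg _) zero_le_one
    _ = ε := one_mul ε

section L2

variable [MeasurableSpace X] [BorelSpace X] (μ : Measure X) [IsLocallyFiniteMeasure μ]

theorem memLp_core (f : S.core) (p : ENNReal) : MemLp f.1 p μ :=
  f.2.2.1.memLp_of_hasCompactSupport f.2.2.2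

/-- The embedding of `F ∩ C_c(X)` into `L²(X, μ)`. -/
def coreToLp : S.core →ₗ[ℝ] Lp ℝ 2 μ where
  toFun f := (S.memLp_core μ f 2).toLp f.1
  map_add' _ _ := rfl
  map_smul' _ _ := rfl

theorem coeFn_coreToLp (f : S.core) : S.coreToLp μ f =ᵐ[μ] f.1 :=
  MemLp.coeFn_toLp (S.memLp_core μ f 2)

theorem norm_coreToLp_sq (f : S.core) : ‖S.coreToLp μ f‖ ^ 2 = ∫ x, f.1 x ^ 2 ∂μ := by
  rw [← real_inner_self_eq_norm_sq, L2.inner_def]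
  refine integral_congr_ae ?_
  filter_upwards [S.coeFn_coreToLp μ f] with x hx
  rw [hx, real_inner_self_eq_norm_sq, Real.norm_eq_abs, sq_abs]

theorem tendsto_coreToLp_iff {f : ℕ → S.core} {u : Lp ℝ 2 μ} :
    Tendsto (fun n => S.coreToLp μ (f n)) atTop (𝓝 u) ↔
      Tendsto (fun n => eLpNorm (fun x => (f n).1 x - u x) 2 μ) atTop (𝓝 0) := by
  have h := Lp.tendsto_Lp_iff_tendsto_eLpNorm'' (fi := atTop) (fun n => (f n).1)
    (fun n => S.memLp_core μ (f n) 2) (u : X → ℝ) (Lp.memLp u)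
  rwa [Lp.toLp_coeFn] at h

theorem toLp_mem_closure_range_coreToLp [ProperSpace X] (V : ExhaustingSequence X)
    (g : C_c(X, ℝ)) (hg : MemLp g 2 μ) : hg.toLp g ∈ closure (Set.range (S.coreToLp μ)) := by
  obtain ⟨K, hK, hgK, happrox⟩ := S.exists_core_dist_le V g
  choose k hkK hk using fun n : ℕ => happrox (1 / ((n : ℝ) + 1)) Nat.one_div_pos_of_nat
  refine mem_closure_of_tendsto (f := fun n => S.coreToLp μ (k n)) (b := atTop) ?_
    (Eventually.of_forall fun n => Set.mem_range_self _)
  refine (Lp.tendsto_Lp_iff_tendsto_eLpNorm'' (fun n => (k n).1)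
    (fun n => S.memLp_core μ (k n) 2) g hg).2 ?_
  refine tendsto_of_tendsto_of_tendsto_of_le_of_le tendsto_const_nhds ?_ (fun _ => zero_le)
    fun n => eLpNorm_sub_le_of_dist_bdd μ ENNReal.ofNat_ne_top hK.measurableSet
      Nat.one_div_pos_of_nat.le (hk n) (hkK n) hgK
  have hzero : Tendsto (fun n : ℕ => ENNReal.ofReal (1 / ((n : ℝ) + 1))) atTop (𝓝 0) := by
    simpa only [ENNReal.ofReal_zero] using
      ENNReal.tendsto_ofReal (tendsto_one_div_add_atTop_nhds_zero_nat (𝕜 := ℝ))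
  have hfinite : μ K ^ (1 / (2 : ENNReal).toReal) ≠ ⊤ :=
    ENNReal.rpow_ne_top_of_nonneg (by positivity) hK.measure_lt_top.ne
  simpa only [zero_mul] using ENNReal.Tendsto.mul_const hzero (Or.inr hfinite)

theorem denseRange_coreToLp [ProperSpace X] (V : ExhaustingSequence X) :
    DenseRange (S.coreToLp μ) := by
  intro u
  rw [← closure_closure, EMetric.mem_closure_iff]
  intro ε hε
  obtain ⟨δ, hδ, hδε⟩ := exists_between hε
  obtain ⟨g, hg_supp, hle, hg_cont, hg⟩ :=
    (Lp.memLp u).exists_hasCompactSupport_eLpNorm_sub_le ENNReal.ofNat_ne_top hδ.ne'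
  refine ⟨hg.toLp g, S.toLp_mem_closure_range_coreToLp μ V ⟨⟨g, hg_cont⟩, hg_supp⟩ hg, ?_⟩
  rw [Lp.edist_def, eLpNorm_congr_ae (EventuallyEq.rfl.sub hg.coeFn_toLp)]
  exact hle.trans_lt hδε

theorem exists_const_of_tendsto_coreToLp_zero [Nonempty X] [μ.IsOpenPosMeasure]
    {f : ℕ → S.core} {v : S.F} (hj : Tendsto (fun n => S.coreToLp μ (f n)) atTop (𝓝 0))
    (hv : Tendsto (fun n => S.E (S.toF (f n) - v) (S.toF (f n) - v)) atTop (𝓝 0)) :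
    ∃ r : ℝ, v.1 = fun _ => r := by
  obtain ⟨ns, hns, hae⟩ := (tendstoInMeasure_of_tendsto_Lp hj).exists_seq_tendsto_ae
  have hf : ∀ᵐ x ∂μ, Tendsto (fun i => (f (ns i)).1 x) atTop (𝓝 0) := by
    filter_upwards [hae, Lp.coeFn_zero ℝ 2 μ, ae_all_iff.2 fun n => S.coeFn_coreToLp μ (f n)]
      with x hx hzero hcoe
    simpa only [hcoe, hzero, Pi.zero_apply] using hx
  obtain ⟨x₀, hx₀⟩ := hf.exists
  have hconst : ∀ᵐ x ∂μ, v.1 x = v.1 x₀ := by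
    filter_upwards [hf] with x hx
    have hdiff := (S.tendsto_diff hv x x₀).comp hns.tendsto_atTop
    have hlim := (hx.sub_const (v.1 x)).sub (hx₀.sub_const (v.1 x₀))
    linarith [tendsto_nhds_unique hdiff hlim]
  exact ⟨v.1 x₀, ((S.continuous_of_mem v).ae_eq_iff_eq μ continuous_const).1 hconst⟩

section Closure

variable [ProperSpace X]

theorem isApprox_iff {f : ℕ → S.core} {u : Lp ℝ 2 μ} :
    S.IsApprox μ f u ↔ Tendsto (fun n => S.coreToLp μ (f n)) atTop (𝓝 u) ∧
      CauchySeq fun n => S.gradLinear V (f n) := by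
  have henergy : (∀ ε > 0, ∃ N, ∀ m ≥ N, ∀ n ≥ N, S.energy (f m - f n) < ε) ↔
      ∀ ε > 0, ∃ N, ∀ m ≥ N, ∀ n ≥ N, ‖S.gradLinear V (f m - f n)‖ < ε := by
    simp only [← S.norm_gradLinear_sq V]
    constructor <;> intro h ε hε
    · obtain ⟨N, hN⟩ := h (ε ^ 2) (by positivity)
      exact ⟨N, fun m hm n hn => lt_of_pow_lt_pow_left₀ 2 hε.le (hN m hm n hn)⟩
    · obtain ⟨N, hN⟩ := h √ε (Real.sqrt_pos.2 hε)
      exact ⟨N, fun m hm n hn => (Real.lt_sqrt (norm_nonneg _)).1 (hN m hm n hn)⟩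
  rw [IsApprox, S.tendsto_coreToLp_iff μ, henergy, Metric.cauchySeq_iff]
  simp only [dist_eq_norm, map_sub]

theorem tendsto_gradLinear_zero [Nonempty X] [μ.IsOpenPosMeasure] (f : ℕ → S.core)
    (hj : Tendsto (fun n => S.coreToLp μ (f n)) atTop (𝓝 0))
    (hd : CauchySeq fun n => S.gradLinear V (f n)) :
    Tendsto (fun n => S.gradLinear V (f n)) atTop (𝓝 0) := by
  obtain ⟨v, hv⟩ := S.complete (fun n => S.toF (f n)) ((S.isApprox_iff V μ).2 ⟨hj, hd⟩).2
  obtain ⟨r, hr⟩ := S.exists_const_of_tendsto_coreToLp_zero μ hj hv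
  obtain rfl : v = ⟨_, S.const_mem r⟩ := Subtype.ext hr
  have henergy (n : ℕ) : S.E (S.toF (f n) - ⟨_, S.const_mem r⟩)
      (S.toF (f n) - ⟨_, S.const_mem r⟩) = ‖S.gradLinear V (f n)‖ ^ 2 := by
    rw [norm_gradLinear_sq, energy, S.energy_sub, S.energy_const_right, S.energy_const]
    ring
  simp only [henergy] at hv
  rw [tendsto_zero_iff_norm_tendsto_zero]
  simpa only [Real.sqrt_sq (norm_nonneg _), Real.sqrt_zero] using hv.sqrt

/-- The domain of the closure of `(E, F ∩ C_c(X))` on `L²(X, μ)` as a Hilbert space, with the norm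
`(E(u) + ‖u‖²)^(1/2)`. It embeds into `L²(X, μ)` by `graphFst`, and the closure of the derivation
`∂` is `graphSnd`. -/
abbrev DirichletSpace := GraphClosure (S.coreToLp μ) (S.gradLinear V)

/-- The inclusion of `F ∩ C_c(X)` into the domain of its closure. -/
abbrev coreToDirichlet : S.core →ₗ[ℝ] S.DirichletSpace V μ :=
  toGraphClosure (S.coreToLp μ) (S.gradLinear V)

theorem injective_graphFst_coreToLp [Nonempty X] [μ.IsOpenPosMeasure] :
    Function.Injective (graphFst : S.DirichletSpace V μ → Lp ℝ 2 μ) :=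
  injective_graphFst (S.tendsto_gradLinear_zero V μ)

variable {V μ}

theorem IsApprox.exists_tendsto {f : ℕ → S.core} {u : Lp ℝ 2 μ} (h : S.IsApprox μ f u) :
    ∃ w : S.DirichletSpace V μ, graphFst w = u ∧
      Tendsto (fun n => S.coreToDirichlet V μ (f n)) atTop (𝓝 w) := by
  obtain ⟨hj, hd⟩ := (S.isApprox_iff V μ).1 h
  obtain ⟨w, hw⟩ := cauchySeq_tendsto_of_complete (cauchySeq_toGraphClosure hj.cauchySeq hd)
  exact ⟨w, tendsto_nhds_unique ((graphFst.continuous.tendsto w).comp hw) hj, hw⟩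

theorem exists_isApprox (w : S.DirichletSpace V μ) : ∃ f, S.IsApprox μ f (graphFst w) := by
  obtain ⟨f, hf⟩ := exists_tendsto_toGraphClosure w
  exact ⟨f, (S.isApprox_iff V μ).2 ⟨(graphFst.continuous.tendsto w).comp hf,
    ((graphSnd.continuous.tendsto w).comp hf).cauchySeq⟩⟩

variable (V) in
theorem mem_domain_iff {u : Lp ℝ 2 μ} :
    u ∈ S.domain μ ↔ ∃ w : S.DirichletSpace V μ, graphFst w = u := by
  refine ⟨fun ⟨f, hf⟩ => ?_, fun ⟨w, hw⟩ => hw ▸ S.exists_isApprox w⟩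
  obtain ⟨w, hw, -⟩ := hf.exists_tendsto S
  exact ⟨w, hw⟩

variable [Nonempty X] [μ.IsOpenPosMeasure] {q : S.core → S.core → ℝ}
  {B : S.DirichletSpace V μ →L[ℝ] S.DirichletSpace V μ →L[ℝ] ℝ}
  (hB : ∀ f g, B (S.coreToDirichlet V μ f) (S.coreToDirichlet V μ g) = q f g)

include hB

theorem isClosureValue (w z : S.DirichletSpace V μ) :
    S.IsClosureValue μ q (graphFst w) (graphFst z) (B w z) := by
  intro f g hf hg
  obtain ⟨w', hw', hfw⟩ := hf.exists_tendsto S (V := V)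
  obtain ⟨z', hz', hgz⟩ := hg.exists_tendsto S (V := V)
  rw [← S.injective_graphFst_coreToLp V μ hw', ← S.injective_graphFst_coreToLp V μ hz']
  exact ((B.continuous₂.tendsto (w', z')).comp (hfw.prodMk_nhds hgz)).congr fun n => hB _ _

theorem closureForm_graphFst (w z : S.DirichletSpace V μ) :
    S.closureForm μ q (graphFst w) (graphFst z) = B w z := by
  have hex : ∃ r, S.IsClosureValue μ q (graphFst w) (graphFst z) r :=
    ⟨_, S.isClosureValue hB w z⟩
  rw [closureForm, dif_pos hex]
  obtain ⟨f, hf⟩ := S.exists_isApprox w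
  obtain ⟨g, hg⟩ := S.exists_isApprox z
  exact tendsto_nhds_unique (hex.choose_spec f g hf hg) (S.isClosureValue hB w z f g hf hg)

theorem isClosureValue_closureForm {u v : Lp ℝ 2 μ} (hu : u ∈ S.domain μ)
    (hv : v ∈ S.domain μ) : S.IsClosureValue μ q u v (S.closureForm μ q u v) := by
  obtain ⟨w, rfl⟩ := (S.mem_domain_iff V).1 hu
  obtain ⟨z, rfl⟩ := (S.mem_domain_iff V).1 hv
  rw [S.closureForm_graphFst hB]
  exact S.isClosureValue hB w z

theorem closureForm_self {p : Lp ℝ 2 μ × Lp ℝ 2 μ} (hp : p ∈ formGenerator B graphFst) :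
    S.closureForm μ q p.1 p.1 = -inner ℝ p.2 p.1 := by
  obtain ⟨w, hw, h⟩ := hp
  rw [← hw, S.closureForm_graphFst hB, h]

theorem generator_eq_formGenerator : S.generator μ q = formGenerator B graphFst := by
  ext p
  constructor
  · rintro ⟨hp, h⟩
    obtain ⟨w, hw⟩ := (S.mem_domain_iff V).1 hp
    refine ⟨w, hw, fun v => ?_⟩
    rw [← S.closureForm_graphFst hB, hw]
    exact h _ ((S.mem_domain_iff V).2 ⟨v, rfl⟩)
  · rintro ⟨w, hw, h⟩
    refine ⟨(S.mem_domain_iff V).2 ⟨w, hw⟩, fun v hv => ?_⟩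
    obtain ⟨z, rfl⟩ := (S.mem_domain_iff V).1 hv
    rw [← hw, S.closureForm_graphFst hB, h]

end Closure

end L2

end RegularResistanceForm

section Multiplication

variable {X : Type*} [MeasurableSpace X] {μ : Measure X} {c : X → ℝ}

/-- Multiplication by an essentially bounded function on `L²`. -/
def mulLp (hc : MemLp c ⊤ μ) : Lp ℝ 2 μ →L[ℝ] Lp ℝ 2 μ :=
  (ContinuousLinearMap.mul ℝ ℝ).holderL μ ⊤ 2 2 (hc.toLp c)

theorem coeFn_mulLp (hc : MemLp c ⊤ μ) (u : Lp ℝ 2 μ) :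
    mulLp hc u =ᵐ[μ] fun x => c x * u x := by
  filter_upwards [(ContinuousLinearMap.mul ℝ ℝ).coeFn_holder (r := 2) (hc.toLp c) u,
    hc.coeFn_toLp] with x hx hcx
  rw [← hcx]
  exact hx

theorem isBoundedUnder_ge_neg (hc : MemLp c ⊤ μ) :
    IsBoundedUnder (· ≥ ·) (ae μ) fun x => -c x := by
  refine ⟨-(eLpNorm c ⊤ μ).toReal, eventually_map.2 ?_⟩
  rw [eLpNorm_exponent_top]
  filter_upwards [ae_le_eLpNormEssSup (f := c) (μ := μ)] with x hx
  have hle : |c x| ≤ (eLpNormEssSup c μ).toReal := by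
    rw [← Real.norm_eq_abs, ← toReal_enorm]
    exact ENNReal.toReal_mono (by rw [← eLpNorm_exponent_top]; exact hc.2.ne) hx
  exact neg_le_neg ((le_abs_self _).trans hle)

theorem inner_mulLp_self_le (hc : MemLp c ⊤ μ) (u : Lp ℝ 2 μ) :
    inner ℝ (mulLp hc u) u ≤ -essInf (fun x => -c x) μ * ‖u‖ ^ 2 := by
  rw [← real_inner_self_eq_norm_sq, L2.inner_def, L2.inner_def, ← integral_const_mul]
  refine integral_mono_ae (L2.integrable_inner _ _) ((L2.integrable_inner _ _).const_mul _) ?_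
  filter_upwards [coeFn_mulLp hc u, ae_essInf_le (isBoundedUnder_ge_neg hc)] with x hx hle
  have hself : inner ℝ (c x * u x) (u x) = c x * inner ℝ (u x) (u x) := by
    rw [← smul_eq_mul, real_inner_smul_left]
  rw [hx, hself]
  exact mul_le_mul_of_nonneg_right (le_neg_of_le_neg hle) real_inner_self_nonneg

end Multiplication

section Drift

variable {x y p p' δ δ' γ γ' : ℝ}

theorem le_sqrt_mul_add_sqrt_mul (hx : 0 ≤ x) (hy : 0 ≤ y) (hδ : 0 ≤ δ) (hγ : 0 ≤ γ)
    (hp : p ^ 2 ≤ δ * x ^ 2 + γ * y ^ 2) : p ≤ √δ * x + √γ * y := by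
  refine le_of_sq_le_sq (hp.trans ?_) (by positivity)
  have hcross : 0 ≤ √δ * x * (√γ * y) := by positivity
  calc δ * x ^ 2 + γ * y ^ 2 = √δ ^ 2 * x ^ 2 + √γ ^ 2 * y ^ 2 := by
        rw [Real.sq_sqrt hδ, Real.sq_sqrt hγ]
    _ ≤ (√δ * x + √γ * y) ^ 2 := by linarith

theorem sqrt_add_sqrt_mul_le {m : ℝ} (hγ : 0 ≤ γ) (hγ' : 0 ≤ γ') (hm : 0 < m) :
    (√γ + √γ') * y * x ≤ m * x ^ 2 + (γ + γ') / (2 * m) * y ^ 2 := by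
  have hsqrt : (√γ + √γ') ^ 2 ≤ 2 * (γ + γ') := by
    simpa only [Real.sq_sqrt hγ, Real.sq_sqrt hγ'] using add_sq_le (a := √γ) (b := √γ')
  have hsquare : 0 ≤ (2 * m * x - (√γ + √γ') * y) ^ 2 / (4 * m) := by positivity
  calc (√γ + √γ') * y * x
      = m * x ^ 2 + (√γ + √γ') ^ 2 / (4 * m) * y ^ 2
          - (2 * m * x - (√γ + √γ') * y) ^ 2 / (4 * m) := by field_simp; ring
    _ ≤ m * x ^ 2 + 2 * (γ + γ') / (4 * m) * y ^ 2 := (sub_le_self _ hsquare).trans (by gcongr)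
    _ = m * x ^ 2 + (γ + γ') / (2 * m) * y ^ 2 := by field_simp; ring

theorem add_mul_le_of_sq_le {m : ℝ} (hx : 0 ≤ x) (hy : 0 ≤ y) (hδ : 0 ≤ δ) (hδ' : 0 ≤ δ')
    (hγ : 0 ≤ γ) (hγ' : 0 ≤ γ') (hm : 0 < m) (hp : p ^ 2 ≤ δ * x ^ 2 + γ * y ^ 2)
    (hp' : p' ^ 2 ≤ δ' * x ^ 2 + γ' * y ^ 2) :
    (p + p') * x ≤ (√δ + √δ' + m) * x ^ 2 + (γ + γ') / (2 * m) * y ^ 2 := by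
  calc (p + p') * x ≤ (√δ * x + √γ * y + (√δ' * x + √γ' * y)) * x := by
        gcongr
        · exact le_sqrt_mul_add_sqrt_mul hx hy hδ hγ hp
        · exact le_sqrt_mul_add_sqrt_mul hx hy hδ' hγ' hp'
    _ = (√δ + √δ') * x ^ 2 + (√γ + √γ') * y * x := by ring
    _ ≤ (√δ + √δ') * x ^ 2 + (m * x ^ 2 + (γ + γ') / (2 * m) * y ^ 2) := by
        gcongr
        exact sqrt_add_sqrt_mul_le hγ hγ' hm
    _ = (√δ + √δ' + m) * x ^ 2 + (γ + γ') / (2 * m) * y ^ 2 := by ring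

end Drift

namespace RegularResistanceForm

variable {X : Type u} [MetricSpace X] [ProperSpace X] (S : RegularResistanceForm X)
  (V : ExhaustingSequence X) [MeasurableSpace X] [BorelSpace X] (μ : Measure X)
  [IsLocallyFiniteMeasure μ]

/-- The extension of `g ↦ g · b` from `F ∩ C_c(X)` to the domain of the closure of the form. It is
meaningful for `b` in the Hardy class only, see `Hardy.actionExtend_coreToDirichlet`. -/
def actionExtend (b : S.VecField V) : S.DirichletSpace V μ →L[ℝ] S.VecField V :=
  (S.actionLinear V b).extendOfNorm (S.coreToDirichlet V μ)

variable {S V μ}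

namespace Hardy

variable {b : S.VecField V} {δ γ : ℝ}

theorem norm_actionLinear_sq_le (hb : S.Hardy V μ b δ γ) (g : S.core) :
    ‖S.actionLinear V b g‖ ^ 2 ≤ δ * ‖S.gradLinear V g‖ ^ 2 + γ * ‖S.coreToLp μ g‖ ^ 2 := by
  rw [norm_coreToLp_sq, norm_gradLinear_sq]
  exact hb.2.2 g

theorem norm_actionLinear_le (hb : S.Hardy V μ b δ γ) (g : S.core) :
    ‖S.actionLinear V b g‖ ≤ √(δ + γ) * ‖S.coreToDirichlet V μ g‖ := by
  obtain ⟨hδ, hγ, -⟩ := id hb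
  refine le_of_sq_le_sq ((hb.norm_actionLinear_sq_le g).trans ?_) (by positivity)
  rw [mul_pow, Real.sq_sqrt (by positivity), norm_graphClosure_sq, graphFst_toGraphClosure,
    graphSnd_toGraphClosure]
  have hj : 0 ≤ δ * ‖S.coreToLp μ g‖ ^ 2 := by positivity
  have hd : 0 ≤ γ * ‖S.gradLinear V g‖ ^ 2 := by positivity
  linarith

theorem actionExtend_coreToDirichlet (hb : S.Hardy V μ b δ γ) (g : S.core) :
    S.actionExtend V μ b (S.coreToDirichlet V μ g) = S.actionLinear V b g := by
  have hdense : DenseRange (S.coreToDirichlet V μ) := denseRange_toGraphClosure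
  have hbound : ∃ C, ∀ f, ‖S.actionLinear V b f‖ ≤ C * ‖S.coreToDirichlet V μ f‖ :=
    ⟨_, hb.norm_actionLinear_le⟩
  exact LinearMap.extendOfNorm_eq hdense hbound g

theorem norm_actionExtend_sq_le (hb : S.Hardy V μ b δ γ) (w : S.DirichletSpace V μ) :
    ‖S.actionExtend V μ b w‖ ^ 2 ≤ δ * ‖graphSnd w‖ ^ 2 + γ * ‖graphFst w‖ ^ 2 := by
  refine denseRange_toGraphClosure.induction_on w (isClosed_le (by fun_prop) (by fun_prop))
    fun g => ?_
  rw [hb.actionExtend_coreToDirichlet]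
  exact hb.norm_actionLinear_sq_le g

end Hardy

variable {a : S.VecField V →L[ℝ] S.VecField V} {b b' : S.VecField V} {c : X → ℝ}
  {lam δ δ' γ γ' lam₀ : ℝ}

variable (a b b') in
/-- The extension of the form `Q` to a bounded bilinear form on the domain of the closure. -/
def extendQ (hc : MemLp c ⊤ μ) : S.DirichletSpace V μ →L[ℝ] S.DirichletSpace V μ →L[ℝ] ℝ :=
  let j : S.DirichletSpace V μ →L[ℝ] Lp ℝ 2 μ := graphFst
  let d : S.DirichletSpace V μ →L[ℝ] S.VecField V := graphSnd
  innerComp (a ∘L d) d - innerComp d (S.actionExtend V μ b)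
    - innerComp (S.actionExtend V μ b') d - innerComp (mulLp hc ∘L j) j

theorem extendQ_coreToDirichlet (hc : MemLp c ⊤ μ) (hb : S.Hardy V μ b δ γ)
    (hb' : S.Hardy V μ b' δ' γ') (f g : S.core) :
    extendQ a b b' hc (S.coreToDirichlet V μ f) (S.coreToDirichlet V μ g) =
      S.formQ V μ a b b' c f g := by
  have hmul : inner ℝ (mulLp hc (S.coreToLp μ f)) (S.coreToLp μ g) =
      ∫ x, c x * f.1 x * g.1 x ∂μ := by
    rw [L2.inner_def]
    refine integral_congr_ae ?_
    filter_upwards [coeFn_mulLp hc (S.coreToLp μ f), S.coeFn_coreToLp μ f, S.coeFn_coreToLp μ g]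
      with x hx hf hg
    rw [hx, hf, hg, real_inner_comm]
    rfl
  simp only [extendQ, sub_apply, innerComp_apply, ContinuousLinearMap.comp_apply,
    graphFst_toGraphClosure, graphSnd_toGraphClosure, hb.actionExtend_coreToDirichlet,
    hb'.actionExtend_coreToDirichlet, hmul, real_inner_comm]
  rfl

theorem le_extendQ (hc : MemLp c ⊤ μ) (hb : S.Hardy V μ b δ γ) (hb' : S.Hardy V μ b' δ' γ')
    (ha : ∀ v, lam * ‖v‖ ^ 2 ≤ inner ℝ (a v) v) (hlam₀ : lam₀ = (lam - √δ - √δ') / 2)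
    (hpos : 0 < lam₀) (w : S.DirichletSpace V μ) :
    lam₀ * ‖graphSnd w‖ ^ 2 +
      (essInf (fun x => -c x) μ - (γ + γ') / (2 * lam₀)) * ‖graphFst w‖ ^ 2 ≤
        extendQ a b b' hc w w := by
  have hdrift := add_mul_le_of_sq_le (norm_nonneg (graphSnd w)) (norm_nonneg (graphFst w))
    hb.1.le hb'.1.le hb.2.1 hb'.2.1 hpos (hb.norm_actionExtend_sq_le w)
    (hb'.norm_actionExtend_sq_le w)
  have hinner := real_inner_le_norm (graphSnd w) (S.actionExtend V μ b w)
  have hinner' := real_inner_le_norm (S.actionExtend V μ b' w) (graphSnd w)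
  have hpotential := inner_mulLp_self_le hc (graphFst w)
  obtain rfl : lam = 2 * lam₀ + √δ + √δ' := by linarith
  simp only [extendQ, sub_apply, innerComp_apply, ContinuousLinearMap.comp_apply]
  linarith [ha (graphSnd w)]

end RegularResistanceForm

section Balls

variable {X : Type*} [PseudoMetricSpace X] [MeasurableSpace X] {μ : Measure X}

theorem isLocallyFiniteMeasure_of_ball {r : ℝ} (hr : 0 < r) (hμ : ∀ x, μ (Metric.ball x r) < ⊤) :
    IsLocallyFiniteMeasure μ :=
  ⟨fun x => ⟨_, Metric.ball_mem_nhds x hr, hμ x⟩⟩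

theorem isOpenPosMeasure_of_ball (hμ : ∀ x r, 0 < r → 0 < μ (Metric.ball x r)) :
    μ.IsOpenPosMeasure where
  open_pos U hU := by
    rintro ⟨x, hx⟩
    obtain ⟨r, hr, hsub⟩ := Metric.isOpen_iff.1 hU x hx
    exact ((hμ x r hr).trans_le (measure_mono hsub)).ne'

end Balls

theorem corollary3p4_general {X : Type u} [MetricSpace X] [ProperSpace X] [Nonempty X]
    [MeasurableSpace X] [BorelSpace X] (S : RegularResistanceForm X) (V : ExhaustingSequence X)
    (μ : Measure X) (a : S.VecField V →L[ℝ] S.VecField V) (b b' : S.VecField V) (c : X → ℝ)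
    {lam δ δ' γ γ' lam₀ c₀ : ℝ}
    (hμ : ∀ (x : X) (r : ℝ), 0 < r → 0 < μ (Metric.ball x r) ∧ μ (Metric.ball x r) < ⊤)
    (ha : ∀ v, lam * ‖v‖ ^ 2 ≤ inner ℝ (a v) v)
    (hb : S.Hardy V μ b δ γ) (hb' : S.Hardy V μ b' δ' γ') (hc : MemLp c ⊤ μ)
    (hlam : lam₀ = (lam - √δ - √δ') / 2) (hlam₀ : 0 < lam₀)
    (hc₀ : c₀ = essInf (fun x => -c x) μ - (γ + γ') / (2 * lam₀)) (hc₀_pos : 0 < c₀) :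
    (∀ u ∈ S.domain μ, ∀ v ∈ S.domain μ, S.IsClosureValue μ (S.formQ V μ a b b' c) u v
      (S.closureForm μ (S.formQ V μ a b b' c) u v)) ∧
    (∃ K, 0 < K ∧ SectorCondition (S.generator μ (S.formQ V μ a b b' c)) (c₀ / 2) K) ∧
    (∃! T : NNReal → Lp ℝ 2 μ →L[ℝ] Lp ℝ 2 μ, IsContractionSemigroup T ∧
      semigroupGenerator T = S.generator μ (S.formQ V μ a b b' c)) ∧
    ∀ T : NNReal → Lp ℝ 2 μ →L[ℝ] Lp ℝ 2 μ, IsContractionSemigroup T →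
      semigroupGenerator T = S.generator μ (S.formQ V μ a b b' c) →
      ∀ u₀ : Lp ℝ 2 μ,
        IsCauchySolution (S.generator μ (S.formQ V μ a b b' c)) u₀
          (fun t => T t.toNNReal u₀) ∧
        (∀ u : ℝ → Lp ℝ 2 μ,
          IsCauchySolution (S.generator μ (S.formQ V μ a b b' c)) u₀ u →
            ∀ t : ℝ, 0 ≤ t → u t = T t.toNNReal u₀) ∧
        (∀ t : ℝ, 0 < t →
          ∃ h, (T t.toNNReal u₀, h) ∈ S.generator μ (S.formQ V μ a b b' c)) ∧
        ∀ K : ℝ, 0 < K →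
          SectorCondition (S.generator μ (S.formQ V μ a b b' c)) (c₀ / 2) K →
          ∀ t : ℝ, 0 < t →
            S.closureForm μ (S.formQ V μ a b b' c) (T t.toNNReal u₀) (T t.toNNReal u₀)
              + ‖T t.toNNReal u₀‖ ^ 2 ≤ (K / 2 / t + 1) * ‖u₀‖ ^ 2 := by
  have := isLocallyFiniteMeasure_of_ball one_pos fun x => (hμ x 1 one_pos).2
  have := isOpenPosMeasure_of_ball fun x r hr => (hμ x r hr).1
  have hQ := S.extendQ_coreToDirichlet (a := a) hc hb hb'
  have hm : 0 < min lam₀ (c₀ / 2) := lt_min hlam₀ (half_pos hc₀_pos)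
  have hcoercive (w : S.DirichletSpace V μ) :=
    (min_mul_norm_sq_add_le lam₀ c₀ w).trans (hc₀ ▸ S.le_extendQ hc hb hb' ha hlam hlam₀ w)
  have hL := mDissipative_formGenerator hm
    (fun w => (le_add_of_nonneg_right (by positivity)).trans (hcoercive w))
    (S.injective_graphFst_coreToLp V μ) (denseRange_graphFst (S.denseRange_coreToLp μ V))
  obtain ⟨K₀, hK₀, hsector₀⟩ := sectorCondition_formGenerator hm hcoercive
  rw [S.generator_eq_formGenerator hQ]
  refine ⟨fun u hu v hv => S.isClosureValue_closureForm hQ hu hv, ⟨K₀, hK₀, hsector₀⟩,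
    hL.existsUnique_semigroup, fun T hT hgen u₀ => ?_⟩
  rw [← hgen] at hsector₀ ⊢
  have hmem (t : ℝ) (ht : 0 < t) : ∃ h, (T t.toNNReal u₀, h) ∈ semigroupGenerator T :=
    (hT.exists_mem_generator_norm_le hsector₀ (by positivity) hK₀.le hL hgen u₀ ht).imp
      fun _ => And.left
  have hsol := hT.isCauchySolution hmem
  refine ⟨hsol, fun u hu t ht => ?_, hmem, fun K hK hsector t ht => ?_⟩
  · rw [hgen] at hu hsol
    exact hu.eq hL.inner_nonpos hsol ht
  · obtain ⟨h, hh⟩ := hmem t ht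
    rw [S.closureForm_self hQ (hgen.subset hh), add_mul, one_mul]
    gcongr
    · exact hT.neg_inner_generator_le hsector (by positivity) hK.le hL hgen u₀ ht hh
    · exact hT.norm_apply_le _ _

end

theorem corollary3p4 :
    ∃ C : ℝ → ℝ, (∀ K, 0 < K → 0 < C K) ∧
    ∀ (X : Type u) [MetricSpace X] [ProperSpace X] [Nonempty X] [MeasurableSpace X] [BorelSpace X]
      (S : RegularResistanceForm X) (V : ExhaustingSequence X) (μ : Measure X)
      (a : S.VecField V →L[ℝ] S.VecField V) (b b' : S.VecField V) (c : X → ℝ)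
      (lam Lam δ δ' γ γ' lam₀ c₀ : ℝ),
      (∀ (x : X) (r : ℝ), 0 < r → 0 < μ (Metric.ball x r) ∧ μ (Metric.ball x r) < ⊤) →
      S.IsUniformlyElliptic V a lam Lam →
      S.Hardy V μ b δ γ → S.Hardy V μ b' δ' γ' →
      MemLp c ⊤ μ →
      lam₀ = (lam - √δ - √δ') / 2 → 0 < lam₀ →
      c₀ = essInf (fun x => - c x) μ - (γ + γ') / (2 * lam₀) → 0 < c₀ →
      -- the form `Q` extends to `D(E)` by continuity
      (∀ u ∈ S.domain μ, ∀ v ∈ S.domain μ, S.IsClosureValue μ (S.formQ V μ a b b' c) u v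
        (S.closureForm μ (S.formQ V μ a b b' c) u v)) ∧
      -- its generator satisfies a sector condition
      (∃ K, 0 < K ∧ SectorCondition (S.generator μ (S.formQ V μ a b b' c)) (c₀ / 2) K) ∧
      -- and generates a unique strongly continuous contraction semigroup
      (∃! T : NNReal → Lp ℝ 2 μ →L[ℝ] Lp ℝ 2 μ, IsContractionSemigroup T ∧
        semigroupGenerator T = S.generator μ (S.formQ V μ a b b' c)) ∧
      ∀ T : NNReal → Lp ℝ 2 μ →L[ℝ] Lp ℝ 2 μ, IsContractionSemigroup T →
        semigroupGenerator T = S.generator μ (S.formQ V μ a b b' c) →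
        ∀ u₀ : Lp ℝ 2 μ,
          IsCauchySolution (S.generator μ (S.formQ V μ a b b' c)) u₀
            (fun t => T t.toNNReal u₀) ∧
          (∀ u : ℝ → Lp ℝ 2 μ,
            IsCauchySolution (S.generator μ (S.formQ V μ a b b' c)) u₀ u →
              ∀ t : ℝ, 0 ≤ t → u t = T t.toNNReal u₀) ∧
          (∀ t : ℝ, 0 < t →
            ∃ h, (T t.toNNReal u₀, h) ∈ S.generator μ (S.formQ V μ a b b' c)) ∧
          ∀ K : ℝ, 0 < K →
            SectorCondition (S.generator μ (S.formQ V μ a b b' c)) (c₀ / 2) K →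
            ∀ t : ℝ, 0 < t →
              S.closureForm μ (S.formQ V μ a b b' c) (T t.toNNReal u₀) (T t.toNNReal u₀)
                + ‖T t.toNNReal u₀‖ ^ 2 ≤ (C K / t + 1) * ‖u₀‖ ^ 2 :=
  ⟨(· / 2), fun _ => half_pos, fun _ _ _ _ _ _ S V μ a b b' c _ _ _ _ _ _ _ _ hμ ha =>
    corollary3p4_general S V μ a b b' c hμ fun v => (ha.2.2.2 v).1⟩
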